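/- Fix a computable enumeration $f_0,f_1,\dots$ of all polynomials with integer coefficients in any number of variables, and for a commutative ring $R$ let $\operatorname{HTP}(R)$ be the set of all $e$ such that $f_e=0$ has a solution with coordinates in $R$. For a set $\mathcal W$ of primes let $\mathbb Z[\mathcal W^{-1}]\subseteq\mathbb Q$ be the subring generated by the inverses of the elements of $\mathcal W$. If $q_1,q_2,\dots$ is an enumeration without repetitions of an infinite set $\mathcal W$ and $\mathcal S\subseteq\mathcal W$, the upper (respectively lower) density of $\mathcal S$ relative to this enumeration of $\mathcal W$ is the $\limsup$ (respectively $\liminf$) of $|\mathcal S\cap\{q_1,\dots,q_n\}|/n$ as $n\to\infty$. There exist a sequence $\mathcal P=\mathcal W_0\supsetneq\mathcal W_1\supsetneq\mathcal W_2\supsetneq\cdots$ of infinite, uniformly computably enumerable sets of primes, where $\mathcal P$ is the set of all primes, and enumerations without repetitions of the sets $\mathcal W_i$, computable uniformly in $i$, the one of $\mathcal W_0=\mathcal P$ being in ascending order, such that 1. $\operatorname{HTP}(\mathbb Z[\mathcal W_i^{-1}])\equiv_T\operatorname{HTP}(\mathbb Q)$ for all $i\ge 0$; 2. for all $i\ge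 1$, the set $\mathcal W_{i-1}\setminus\mathcal W_i$ has upper density $1$ relative to the enumeration of $\mathcal W_{i-1}$; 3. for all $i\ge 1$, the set $\mathcal W_i$ has lower density $0$ relative to the enumeration of $\mathcal W_{i-1}$. -/

import Mathlib

/-- The polynomial over `ℤ` in the variables `X₀, X₁, …` presented by a finite list of terms:
the pair `(c, [a₀, …, aₖ])` stands for the term `c * X₀ ^ a₀ * ⋯ * Xₖ ^ aₖ`. -/
noncomputable def polyOfTerms (t : List (ℤ × List ℕ)) : MvPolynomial ℕ ℤ :=
  (t.map fun c => MvPolynomial.monomial c.2.toFinsupp c.1).sum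

/-- A computable enumeration `f₀, f₁, …` of all polynomials with integer coefficients, in any
number of variables: `e` is decoded to the `e`-th finite list of terms. -/
noncomputable def polyEnum (e : ℕ) : MvPolynomial ℕ ℤ :=
  polyOfTerms (Denumerable.ofNat (List (ℤ × List ℕ)) e)

/-- Every polynomial occurs in the enumeration. -/
theorem polyEnum_surjective : Function.Surjective polyEnum := by
  intro f
  suffices h : ∃ t, polyOfTerms t = f by
    obtain ⟨t, rfl⟩ := h
    exact ⟨Encodable.encode t, by simp [polyEnum]⟩
  induction f using MvPolynomial.induction_on' with
  | monomial u a =>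
    obtain ⟨l, hl⟩ : ∃ l : List ℕ, l.toFinsupp = u := by
      refine ⟨(List.range (u.support.sup id + 1)).map u, ?_⟩
      ext i
      by_cases hi : i < u.support.sup id + 1
      · simp [List.getD_eq_getElem?_getD, hi]
      · have h0 : u i = 0 := by
          by_contra hne
          have := Finset.le_sup (f := id) (Finsupp.mem_support_iff.2 hne)
          simp only [id] at this hi
          omega
        simp [List.getD_eq_getElem?_getD, hi, h0]
    exact ⟨[(a, l)], by simp [polyOfTerms, hl]⟩
  | add p q hp hq =>
    obtain ⟨t, rfl⟩ := hp
    obtain ⟨t', rfl⟩ := hq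
    exact ⟨t ++ t', by simp [polyOfTerms]⟩

/-- Hilbert's Tenth Problem over `R`: the set of indices of the integer polynomials that have a
root with coordinates in `R`. (Only finitely many variables occur in a polynomial, so the values
at the other ones are irrelevant.) -/
def HTP (R : Type*) [CommRing R] : Set ℕ :=
  {e | ∃ x : ℕ → R, MvPolynomial.aeval x (polyEnum e) = 0}

/-- The characteristic function of a set of natural numbers. -/
noncomputable def charFun (A : Set ℕ) : ℕ →. ℕ :=
  fun n => Part.some (A.indicator (fun _ => 1) n)

/-- Turing equivalence of sets of natural numbers. -/
def SetTuringEquivalent (A B : Set ℕ) : Prop :=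
  TuringEquivalent (charFun A) (charFun B)

/-- The subring `ℤ[S⁻¹]` of `ℚ`. -/
def invertPrimes (S : Set ℕ) : Subring ℚ :=
  Subring.closure ((fun p : ℕ => (p : ℚ)⁻¹) '' S)

/-- The sets `W 0, W 1, …` are uniformly computably enumerable. -/
def UniformlyCE (W : ℕ → Set ℕ) : Prop :=
  REPred fun x : ℕ × ℕ => x.2 ∈ W x.1

/-- `q i` enumerates the (infinite) set `W i` without repetitions, computably and uniformly
in `i`. -/
structure IsUniformEnumeration (W : ℕ → Set ℕ) (q : ℕ → ℕ → ℕ) : Prop where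
  computable : Computable₂ q
  injective : ∀ i, Function.Injective (q i)
  range_eq : ∀ i, Set.range (q i) = W i

/-- The proportion `|S ∩ {q 0, …, q (n - 1)}| / n`. -/
noncomputable def relProportion (q : ℕ → ℕ) (S : Set ℕ) (n : ℕ) : ℝ :=
  ((S ∩ q '' Set.Iio n).ncard : ℝ) / n

/-- The upper density of `S` relative to the set enumerated by `q`. -/
noncomputable def relUpperDensity (q : ℕ → ℕ) (S : Set ℕ) : ℝ :=
  Filter.limsup (relProportion q S) Filter.atTop

/-- The lower density of `S` relative to the set enumerated by `q`. -/
noncomputable def relLowerDensity (q : ℕ → ℕ) (S : Set ℕ) : ℝ :=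
  Filter.liminf (relProportion q S) Filter.atTop

/-! Each set is obtained from the previous one, given by an enumeration `q`, through a finite-injury
construction. Requirement `e` codes a polynomial f and an odd number N. It looks for a root of f
whose denominators are products of terms of `q` that do not divide N and whose positions are not
restrained with higher priority. On finding one it acts: all positions so far that are not
restrained with higher priority are enumerated, and the weaker requirements start afresh. Priority
`e` restrains the positions from m up to m(e + 2), where m exceeds the stages of the current actions
of priority at most `e`. Every requirement acts finitely often, and the final restraints are never
violated (`not_mem_thinned_of_restrained`), so at most m of the first m(e + 2) terms survive. This
gives lower density 0, and upper density 1 for the complement.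

The same restraints control the Turing degree. Requirement `e` ends up with an action if and only if
f has a root over the thinned set without the divisors of N (`finalAction_ne_zero_iff`), and also if
and only if f has a root over the old set without the divisors of N and the finitely many terms
finally restrained with higher priority (`finalAction_ne_zero_iff_not_restrained`). So the induction
is carried by `levelProblem`, where finitely many odd primes may be excluded. Given the final
actions of higher priority, one query to the previous level tells whether `e` finally acts, and in
that case a search finds when (`finalAction_eq_of_agree`). Position 0, which carries the prime 2, is
never restrained, so only odd primes are ever excluded.

At level 0 the problem concerns semilocal subrings of ℚ, and it reduces to ℚ uniformly
(`exists_semilocal_reduction`). For odd N, choose P and u so that the quaternion algebra (u, P)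
ramifies at all primes dividing N. Its norm one equation forces integrality at those primes
(`QuaternionSolvable.not_dvd_den`) and is solvable at every integer (`exists_quaternion_norm`, by
two Legendre equations sharing an auxiliary prime). Inverting numbers 1 + Pt then reaches the whole
semilocal ring. Conversely, `HTP ℚ` reduces to every subring of ℚ by clearing denominators, a sum of
four squares plus 1 keeping the denominator nonzero. -/

/-! ### Ternary quadratic forms and the norm one equation at integers -/

/-- Pigeonhole principle for three linear congruences. -/
theorem exists_small_congruence_solution {a b c : ℕ} (ha : 0 < a) (hb : 0 < b) (hc : 0 < c)
    (k₁ : ZMod a) (k₂ : ZMod b) (k₃ : ZMod c) :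
    ∃ x y z : ℤ, (x ≠ 0 ∨ y ≠ 0 ∨ z ≠ 0) ∧ x ^ 2 ≤ b * c ∧ y ^ 2 ≤ a * c ∧ z ^ 2 ≤ a * b ∧
      (y : ZMod a) = k₁ * z ∧ (x : ZMod b) = k₂ * z ∧ (x : ZMod c) = k₃ * y := by
  have : NeZero a := ⟨ha.ne'⟩
  have : NeZero b := ⟨hb.ne'⟩
  have : NeZero c := ⟨hc.ne'⟩
  set s₁ := Nat.sqrt (b * c) with hs₁
  set s₂ := Nat.sqrt (a * c) with hs₂
  set s₃ := Nat.sqrt (a * b) with hs₃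
  let S : Finset (ℕ × ℕ × ℕ) :=
    Finset.range (s₁ + 1) ×ˢ Finset.range (s₂ + 1) ×ˢ Finset.range (s₃ + 1)
  let f : ℕ × ℕ × ℕ → ZMod a × ZMod b × ZMod c := fun t =>
    ((t.2.1 : ZMod a) - k₁ * t.2.2, (t.1 : ZMod b) - k₂ * t.2.2, (t.1 : ZMod c) - k₃ * t.2.1)
  have hcard : (Finset.univ : Finset (ZMod a × ZMod b × ZMod c)).card < S.card := by
    simp only [Finset.card_univ, Fintype.card_prod, ZMod.card, S, Finset.card_product,
      Finset.card_range]
    have h₁ : b * c < (s₁ + 1) * (s₁ + 1) := Nat.lt_succ_sqrt _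
    have h₂ : a * c < (s₂ + 1) * (s₂ + 1) := Nat.lt_succ_sqrt _
    have h₃ : a * b < (s₃ + 1) * (s₃ + 1) := Nat.lt_succ_sqrt _
    -- The product of the three bounds says that (abc)² is less than the square of the size of the
    -- box.
    have h := Nat.mul_lt_mul'' (Nat.mul_lt_mul'' h₁ h₂) h₃
    by_contra! hle
    have := Nat.mul_le_mul hle hle
    nlinarith
  obtain ⟨t, ht, t', ht', hne, heq⟩ :=
    Finset.exists_ne_map_eq_of_card_lt_of_maps_to hcard (fun t _ => Finset.mem_univ (f t))
  obtain ⟨x, y, z⟩ := t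
  obtain ⟨x', y', z'⟩ := t'
  simp only [S, Finset.mem_product, Finset.mem_range, Nat.lt_succ_iff] at ht ht'
  simp only [f, Prod.mk.injEq] at heq
  have key : ∀ {m n s k : ℕ}, s = Nat.sqrt k → m ≤ s → n ≤ s → ((m : ℤ) - n) ^ 2 ≤ k := by
    intro m n s k hs hm hn
    have hk : (s : ℤ) * s ≤ k := by exact_mod_cast hs ▸ Nat.sqrt_le k
    have hm' : (m : ℤ) ≤ s := by exact_mod_cast hm
    have hn' : (n : ℤ) ≤ s := by exact_mod_cast hn
    have hm0 : (0 : ℤ) ≤ m := by positivity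
    have hn0 : (0 : ℤ) ≤ n := by positivity
    nlinarith
  refine ⟨x - x', y - y', z - z', ?_, ?_, ?_, ?_, ?_, ?_, ?_⟩
  · by_contra! h
    apply hne
    simp only [Prod.mk.injEq]
    omega
  · exact_mod_cast key hs₁ ht.1 ht'.1
  · exact_mod_cast key hs₂ ht.2.1 ht'.2.1
  · exact_mod_cast key hs₃ ht.2.2 ht'.2.2
  · push_cast; linear_combination heq.1
  · push_cast; linear_combination heq.2.1
  · push_cast; linear_combination heq.2.2

/-- A case of Legendre's theorem on ternary quadratic forms. -/
theorem exists_ternary_zero {a b r : ℕ} (ha : 0 < a) (hb : 0 < b) (hr : r.Prime)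
    (hab : a.Coprime b) (har : a.Coprime r) (hbr : b.Coprime r)
    (h₁ : ∃ k : ZMod a, b * k ^ 2 = -r) (h₂ : ∃ k : ZMod b, a * k ^ 2 = r)
    (h₃ : ∃ k : ZMod r, a * k ^ 2 = b) :
    ∃ x y z : ℤ, x ≠ 0 ∧ a * x ^ 2 = b * y ^ 2 + r * z ^ 2 := by
  obtain ⟨k₁, hk₁⟩ := h₁
  obtain ⟨k₂, hk₂⟩ := h₂
  obtain ⟨k₃, hk₃⟩ := h₃
  have haZ : (0 : ℤ) < a := by exact_mod_cast ha
  have hbZ : (0 : ℤ) < b := by exact_mod_cast hb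
  have hrZ : (0 : ℤ) < r := by exact_mod_cast hr.pos
  -- The right-hand side is positive definite, so a nontrivial zero has x ≠ 0.
  suffices h : ∃ x y z : ℤ, (x ≠ 0 ∨ y ≠ 0 ∨ z ≠ 0) ∧ a * x ^ 2 = b * y ^ 2 + r * z ^ 2 by
    obtain ⟨x, y, z, hne, h⟩ := h
    refine ⟨x, y, z, ?_, h⟩
    rintro rfl
    have hy : y = 0 := by
      by_contra hy
      have : 0 < y ^ 2 := by positivity
      nlinarith [sq_nonneg z, mul_pos hbZ this, mul_nonneg hrZ.le (sq_nonneg z)]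
    subst hy
    have hz : z = 0 := by
      by_contra hz
      have : 0 < z ^ 2 := by positivity
      nlinarith [mul_pos hrZ this]
    simp_all
  obtain ⟨x, y, z, hne, hx, hy, hz, e₁, e₂, e₃⟩ :=
    exists_small_congruence_solution ha hb hr.pos k₁ k₂ k₃
  set Q : ℤ := a * x ^ 2 - b * y ^ 2 - r * z ^ 2 with hQ
  have d₁ : (a : ℤ) ∣ Q := by
    rw [← ZMod.intCast_zmod_eq_zero_iff_dvd] 
    simp only [hQ]; push_cast
    rw [e₁, ZMod.natCast_self]
    linear_combination -(z : ZMod a) ^ 2 * hk₁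
  have d₂ : (b : ℤ) ∣ Q := by
    rw [← ZMod.intCast_zmod_eq_zero_iff_dvd]
    simp only [hQ]; push_cast
    rw [e₂, ZMod.natCast_self]
    linear_combination (z : ZMod b) ^ 2 * hk₂
  have d₃ : (r : ℤ) ∣ Q := by
    rw [← ZMod.intCast_zmod_eq_zero_iff_dvd]
    simp only [hQ]; push_cast
    rw [e₃, ZMod.natCast_self]
    linear_combination (y : ZMod r) ^ 2 * hk₃
  have cop₁ : IsCoprime (a : ℤ) b := Nat.isCoprime_iff_coprime.2 hab
  have cop₂ : IsCoprime (a * b : ℤ) r :=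
    IsCoprime.mul_left (Nat.isCoprime_iff_coprime.2 har) (Nat.isCoprime_iff_coprime.2 hbr)
  obtain ⟨m, hm⟩ : (a * b * r : ℤ) ∣ Q := cop₂.mul_dvd (cop₁.mul_dvd d₁ d₂) d₃
  -- The prime r divides n * r exactly once. This makes the bounds on x and y strict and confines Q
  -- strictly between -2abr and abr; the bound on z may stay weak.
  have not_sq : ∀ (n : ℕ) (w : ℤ), 0 < n → n.Coprime r → w ^ 2 ≠ n * r := by
    intro n w hn hc hw
    have hrp : Prime (r : ℤ) := Nat.prime_iff_prime_int.1 hr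
    obtain ⟨v, rfl⟩ : (r : ℤ) ∣ w := hrp.dvd_of_dvd_pow (n := 2) (hw ▸ Dvd.intro_left _ rfl)
    have : (n : ℤ) = r * v ^ 2 := by
      apply mul_right_cancel₀ hrZ.ne'
      linear_combination -hw
    have hd : r ∣ n := by exact_mod_cast Dvd.intro _ this.symm
    exact hr.one_lt.ne' (Nat.Coprime.eq_one_of_dvd hc.symm hd)
  have hx' : x ^ 2 < b * r := lt_of_le_of_ne hx (not_sq b x hb hbr)
  have hy' : y ^ 2 < a * r := lt_of_le_of_ne hy (not_sq a y ha har)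
  have hpos : (0 : ℤ) < a * b * r := by positivity
  have hup : Q < a * b * r := by
    have := mul_lt_mul_of_pos_left hx' haZ
    nlinarith [mul_nonneg hbZ.le (sq_nonneg y), mul_nonneg hrZ.le (sq_nonneg z)]
  have hlo : -2 * (a * b * r) < Q := by
    have h1 := mul_lt_mul_of_pos_left hy' hbZ
    have h2 := mul_le_mul_of_nonneg_left hz hrZ.le
    nlinarith [mul_nonneg haZ.le (sq_nonneg x)]
  have hm1 : m < 1 := by nlinarith
  have hm2 : -2 < m := by nlinarith
  obtain rfl | rfl : m = 0 ∨ m = -1 := by omega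
  · exact ⟨x, y, z, hne, by linear_combination hm⟩
  -- The identity a(xz + by)² - b(ax + yz)² = (ax² - by²)(z² - ab) turns Q = -abr into a zero with
  -- last coordinate z² - ab. If z² = ab, then ax² = by², and a zero with last coordinate 0 is at
  -- hand.
  · have hE : (r : ℤ) * (z ^ 2 - a * b) = a * x ^ 2 - b * y ^ 2 := by linear_combination -hm
    by_cases hzz : z ^ 2 - a * b = 0
    · by_cases hxy : x = 0 ∧ y = 0
      · refine ⟨b, z, 0, Or.inl hbZ.ne', ?_⟩
        linear_combination -(b : ℤ) * hzz
      · refine ⟨x, y, 0, by tauto, ?_⟩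
        linear_combination -hE + r * hzz
    · exact ⟨x * z + b * y, a * x + y * z, z ^ 2 - a * b, Or.inr (Or.inr hzz), by
        linear_combination -(z ^ 2 - a * b : ℤ) * hE⟩

theorem isSquare_zmod_of_jacobiSym_eq_one {r : ℕ} (hr : r.Prime) {n : ℕ}
    (h : jacobiSym n r = 1) : IsSquare (n : ZMod r) := by
  have : Fact r.Prime := ⟨hr⟩
  rw [← jacobiSym.legendreSym.to_jacobiSym] at h
  by_cases h0 : ((n : ℤ) : ZMod r) = 0
  · rw [(legendreSym.eq_zero_iff r n).2 h0] at h; simp at h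
  · exact_mod_cast (legendreSym.eq_one_iff r h0).1 h

/-- By reciprocity the symbol depends only on r modulo 4a, so r may be replaced by 1. -/
theorem jacobiSym_eq_one_of_mod_eq_one {a r : ℕ} (hr : Odd r) (ha : 0 < a) (h : r ≡ 1 [MOD 4 * a]) :
    jacobiSym a r = 1 := by
  rw [jacobiSym.mod_right _ hr, Int.natAbs_natCast, h, Nat.mod_eq_of_lt (by omega)]
  exact jacobiSym.one_right _

/-- An integral multiple of `2 * u` occurs in the norm one equation of the quaternion algebra
`(u, P)`. -/
theorem exists_quaternion_norm {P u : ℕ} (hP : 0 < P) (hu : 0 < u) (x : ℤ) :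
    ∃ a b d : ℚ, 1 + 4 * P * u ^ 2 * (x : ℚ) ^ 2 = a ^ 2 - u * b ^ 2 + P * u * d ^ 2 := by
  set c : ℕ := 1 + 4 * P * u ^ 2 * x.natAbs ^ 2 with hc
  have hx2 : (x.natAbs : ℚ) ^ 2 = (x : ℚ) ^ 2 := by
    rw [← Int.cast_natCast (R := ℚ), ← Int.cast_pow, Int.natAbs_sq, Int.cast_pow]
  have hcQ : (c : ℚ) = 1 + 4 * P * u ^ 2 * (x : ℚ) ^ 2 := by rw [hc]; push_cast; rw [hx2]
  have hc1 : c ≡ 1 [MOD 4 * u] := by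
    rw [hc]
    have : 4 * P * u ^ 2 * x.natAbs ^ 2 ≡ 0 [MOD 4 * u] :=
      (Nat.modEq_zero_iff_dvd).2 ⟨P * u * x.natAbs ^ 2, by ring⟩
    simpa using this.add_left 1
  have hcP : (4 * (P * u)).Coprime c := by
    have : c = 1 + (4 * (P * u)) * (u * x.natAbs ^ 2) := by rw [hc]; ring
    rw [this]; simp
  have hcPu : (P * u).Coprime c := Nat.Coprime.coprime_mul_left hcP
  have hcu : u.Coprime c := Nat.Coprime.coprime_mul_left hcPu
  -- Dirichlet's theorem will give a prime r congruent to 1 modulo 4Pu and to u modulo c. These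
  -- congruences supply all residue conditions for the two ternary equations below.
  obtain ⟨v, hv₁, hv₂⟩ := Nat.chineseRemainder hcP 1 u
  have hvc : v.Coprime (4 * (P * u) * c) := by
    apply Nat.Coprime.mul_right
    · rw [Nat.Coprime, hv₁.gcd_eq]; simp
    · rw [Nat.Coprime, hv₂.gcd_eq]; exact hcu
  have hcpos : 0 < c := by omega
  obtain ⟨r, hrgt, hr, hrv⟩ := Nat.forall_exists_prime_gt_and_modEq (c + P * u + 2)
    (by positivity : 4 * (P * u) * c ≠ 0) hvc
  have hr₁ : r ≡ 1 [MOD 4 * (P * u)] := (hrv.of_mul_right _).trans hv₁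
  have hr₂ : r ≡ u [MOD c] := (hrv.of_mul_left _).trans hv₂
  have hrodd : Odd r := hr.odd_of_ne_two (by omega)
  have hr4 : r % 4 = 1 := (hr₁.of_mul_right _)
  have hr₁u : r ≡ 1 [MOD 4 * u] := hr₁.of_dvd ⟨P, by ring⟩
  have hcop : ∀ n, 0 < n → n < r → n.Coprime r := fun n h h' =>
    (Nat.coprime_of_lt_prime h.ne' h' hr).symm
  have hPu : 0 < P * u := by positivity
  have hule : u ≤ P * u := Nat.le_mul_of_pos_left _ hP
  have hju : jacobiSym u r = 1 := jacobiSym_eq_one_of_mod_eq_one hrodd hu hr₁u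
  have hjPu : jacobiSym (P * u : ℕ) r = 1 := jacobiSym_eq_one_of_mod_eq_one hrodd hPu hr₁
  have hc4 : c % 4 = 1 := hc1.of_mul_right _
  -- Since c ≡ 1 mod 4, the symbol (c/r) equals (r/c) = (u/c), and c ≡ 1 mod 4u.
  have hjc : jacobiSym c r = 1 := by
    rw [jacobiSym.quadratic_reciprocity_one_mod_four hc4 hrodd,
      jacobiSym.mod_left' (a₂ := (u : ℤ)) (by exact_mod_cast hr₂)]
    exact jacobiSym_eq_one_of_mod_eq_one (Nat.odd_iff.2 (Nat.odd_of_mod_four_eq_one hc4)) hu hc1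
  have : Fact r.Prime := ⟨hr⟩
  have hcne : (c : ZMod r) ≠ 0 := by
    rw [Ne, ZMod.natCast_eq_zero_iff]
    exact fun h => absurd (Nat.le_of_dvd hcpos h) (by omega)
  -- X² = uY² + rZ² makes r a value of a² - ub² when Z ≠ 0. The second equation writes c as Pud²
  -- plus r times a square; eliminating r gives the claim.
  obtain ⟨X, Y, Z, hX, hE⟩ := exists_ternary_zero one_pos hu hr (Nat.coprime_one_left _)
    (Nat.coprime_one_left _) (hcop u hu (by omega)) ⟨0, Subsingleton.elim _ _⟩
    ⟨1, by
      have := (ZMod.natCast_eq_natCast_iff _ _ _).2 (hr₁.of_dvd ⟨4 * P, by ring⟩ : r ≡ 1 [MOD u])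
      simp [this]⟩
    (by
      obtain ⟨k, hk⟩ := isSquare_zmod_of_jacobiSym_eq_one hr hju
      exact ⟨k, by rw [hk]; push_cast; ring⟩)
  obtain ⟨X', Y', Z', hX', hE'⟩ := exists_ternary_zero hcpos hPu hr hcPu.symm
    (hcop c hcpos (by omega)) (hcop _ hPu (by omega))
    -- Pu(2ux)² = u(c - 1) ≡ -u ≡ -r modulo c.
    ⟨2 * u * x, by
      have h1 := (ZMod.natCast_eq_natCast_iff _ _ _).2 hr₂
      have h2 : (c : ZMod c) = 0 := ZMod.natCast_self c
      have h3 : (c : ZMod c) = 1 + 4 * P * u ^ 2 * (x : ZMod c) ^ 2 := by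
        have : (c : ℤ) = 1 + 4 * P * u ^ 2 * x ^ 2 := by exact_mod_cast hcQ
        exact_mod_cast congrArg (Int.cast : ℤ → ZMod c) this
      rw [h1]; push_cast
      linear_combination (u : ZMod c) * h2 - (u : ZMod c) * h3⟩
    ⟨1, by
      have h1 := (ZMod.natCast_eq_natCast_iff _ _ _).2
        (hr₁.of_dvd ⟨4, by ring⟩ : r ≡ 1 [MOD P * u])
      have h2 := (ZMod.natCast_eq_natCast_iff c 1 (P * u)).2
        ((Nat.modEq_iff_dvd' (by omega)).2 ⟨4 * u * x.natAbs ^ 2, by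
          rw [hc, Nat.add_sub_cancel_left]; ring⟩ : 1 ≡ c [MOD P * u]).symm
      rw [h1, h2]; simp⟩
    (by
      obtain ⟨k, hk⟩ := isSquare_zmod_of_jacobiSym_eq_one hr hjc
      obtain ⟨l, hl⟩ := isSquare_zmod_of_jacobiSym_eq_one hr hjPu
      refine ⟨l / k, ?_⟩
      have hk0 : k ≠ 0 := by rintro rfl; exact hcne (by simpa using hk)
      rw [hk, hl]; field_simp)
  have hXQ : (X : ℚ) ≠ 0 := by exact_mod_cast hX
  have hX'Q : (X' : ℚ) ≠ 0 := by exact_mod_cast hX'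
  have hEQ : (X : ℚ) ^ 2 = u * Y ^ 2 + r * Z ^ 2 := by
    have := congrArg (Int.cast : ℤ → ℚ) hE; push_cast at this; linarith
  have hE'Q : (c : ℚ) * X' ^ 2 = P * u * Y' ^ 2 + r * Z' ^ 2 := by
    have := congrArg (Int.cast : ℤ → ℚ) hE'; push_cast at this; linarith
  rw [← hcQ]
  -- If Z = 0, then u is a rational square and a² - ub² represents everything, by c = ((c + 1)/2)² -
  -- ((c - 1)/2)².
  by_cases hZQ : (Z : ℚ) = 0
  · have hYQ : (Y : ℚ) ≠ 0 := by
      intro h0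
      rw [h0, hZQ] at hEQ
      exact hXQ (by simpa using hEQ)
    rw [hZQ] at hEQ
    refine ⟨(c + 1) / 2, (c - 1) / 2 * (Y / X), 0, ?_⟩
    field_simp
    linear_combination -((c : ℚ) - 1) ^ 2 * hEQ
  refine ⟨X / Z * (Z' / X'), Y / Z * (Z' / X'), Y' / X', ?_⟩
  field_simp
  linear_combination (Z : ℚ) ^ 2 * hE'Q - Z' ^ 2 * hEQ

/-! ### Existential description of semilocal subrings of ℚ -/

/-- The equation `1 + 4 * P * u ^ 2 * x ^ 2 = a ^ 2 - u * b ^ 2 + P * u * d ^ 2` is solvable. -/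
def QuaternionSolvable (P u : ℕ) (x : ℚ) : Prop :=
  ∃ a b d : ℚ, 1 + 4 * P * u ^ 2 * x ^ 2 = a ^ 2 - u * b ^ 2 + P * u * d ^ 2

/-- The binary form is anisotropic modulo p: a zero with y invertible would make u the square of x /
y. -/
theorem dvd_of_dvd_sq_sub_mul_sq {p u : ℕ} (hp : p.Prime) (hu : ¬ IsSquare (u : ZMod p)) {x y : ℤ}
    (h : (p : ℤ) ∣ x ^ 2 - u * y ^ 2) : (p : ℤ) ∣ x ∧ (p : ℤ) ∣ y := by
  have : Fact p.Prime := ⟨hp⟩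
  simp only [← ZMod.intCast_zmod_eq_zero_iff_dvd] at h ⊢
  push_cast at h
  have hy : (y : ZMod p) = 0 := by
    by_contra hy
    exact hu ⟨x / y, by field_simp; linear_combination -h⟩
  rw [hy] at h
  exact ⟨by simpa using h, hy⟩

/-- The algebra (u, P) is ramified at p, so its norm form is anisotropic there and norm one elements
are p-integral. Concretely this is a descent on a common denominator n. If p ∣ n, anisotropy modulo
p first makes A and B divisible by p; after cancelling one p the same applies to D and 2X, and n / p
is a smaller common denominator. -/
theorem QuaternionSolvable.not_dvd_den {p P u : ℕ} (hp : p.Prime) (hp2 : p ≠ 2) (hP : p ∣ P)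
    (hP2 : ¬ p ^ 2 ∣ P) (hu : ¬ IsSquare (u : ZMod p)) {x : ℚ} (h : QuaternionSolvable P u x) :
    ¬ p ∣ x.den := by
  obtain ⟨a, b, d, h⟩ := h
  have hpZ : Prime (p : ℤ) := Nat.prime_iff_prime_int.1 hp
  have hp0 : (p : ℤ) ≠ 0 := hpZ.ne_zero
  have hex : ∃ n : ℕ, 0 < n ∧ ∃ X A B D : ℤ,
      (X : ℚ) = n * x ∧ (A : ℚ) = n * a ∧ (B : ℚ) = n * b ∧ (D : ℚ) = n * d := by
    refine ⟨x.den * a.den * b.den * d.den, by positivity, x.num * a.den * b.den * d.den,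
      x.den * a.num * b.den * d.den, x.den * a.den * b.num * d.den,
      x.den * a.den * b.den * d.num, ?_, ?_, ?_, ?_⟩ <;> push_cast
    · linear_combination -(a.den * b.den * d.den : ℚ) * x.mul_den_eq_num
    · linear_combination -(x.den * b.den * d.den : ℚ) * a.mul_den_eq_num
    · linear_combination -(x.den * a.den * d.den : ℚ) * b.mul_den_eq_num
    · linear_combination -(x.den * a.den * b.den : ℚ) * d.mul_den_eq_num
  classical
  have hmin := fun m => Nat.find_min hex (m := m)
  obtain ⟨hn, X, A, B, D, hX, hA, hB, hD⟩ := Nat.find_spec hex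
  generalize Nat.find hex = n at *
  have hE : (n : ℤ) ^ 2 + 4 * P * u ^ 2 * X ^ 2 = A ^ 2 - u * B ^ 2 + P * u * D ^ 2 := by
    have : (n : ℚ) ^ 2 + 4 * P * u ^ 2 * X ^ 2 = A ^ 2 - u * B ^ 2 + P * u * D ^ 2 := by
      rw [hX, hA, hB, hD]; linear_combination (n : ℚ) ^ 2 * h
    exact_mod_cast this
  have hpn : ¬ p ∣ n := by
    rintro ⟨n', rfl⟩
    obtain ⟨P', rfl⟩ := hP
    obtain ⟨⟨A', rfl⟩, ⟨B', rfl⟩⟩ := dvd_of_dvd_sq_sub_mul_sq hp hu (x := A) (y := B) (by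
      refine ⟨p * n' ^ 2 + 4 * P' * u ^ 2 * X ^ 2 - P' * u * D ^ 2, ?_⟩
      push_cast at hE
      linear_combination -hE)
    have h1 : (p : ℤ) ∣ P' * (u * (D ^ 2 - u * (2 * X) ^ 2)) := by
      refine ⟨n' ^ 2 - A' ^ 2 + u * B' ^ 2, ?_⟩
      push_cast at hE
      apply mul_left_cancel₀ hp0
      linear_combination -hE
    have h2 := hpZ.dvd_or_dvd h1
    rcases h2 with h2 | h2
    · apply hP2
      rw [pow_two]
      exact mul_dvd_mul_left p (by exact_mod_cast h2)
    rcases hpZ.dvd_or_dvd h2 with h2 | h2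
    · apply hu
      rw [(ZMod.natCast_eq_zero_iff u p).2 (by exact_mod_cast h2)]
      exact ⟨0, by simp⟩
    obtain ⟨⟨D', rfl⟩, h3⟩ := dvd_of_dvd_sq_sub_mul_sq hp hu h2
    rcases hpZ.dvd_or_dvd h3 with h3 | ⟨X', rfl⟩
    · have : p ∣ 2 := by exact_mod_cast h3
      exact hp2 ((Nat.prime_dvd_prime_iff_eq hp Nat.prime_two).1 this)
    have hpQ : (p : ℚ) ≠ 0 := by exact_mod_cast hp0
    push_cast at hX hA hB hD
    refine hmin n' ?_ ⟨Nat.pos_of_mul_pos_left hn, X', A', B', D', ?_, ?_, ?_, ?_⟩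
    · have := Nat.pos_of_mul_pos_left hn
      nlinarith [hp.two_le]
    all_goals apply mul_left_cancel₀ hpQ
    · linear_combination hX
    · linear_combination hA
    · linear_combination hB
    · linear_combination hD
  intro hpx
  apply hpn
  have hx : x = (X : ℚ) / (n : ℤ) := by
    have : (n : ℚ) ≠ 0 := by positivity
    push_cast
    field_simp
    linear_combination -hX
  have : (x.den : ℤ) ∣ n := by
    rw [hx, ← Rat.divInt_eq_div]; exact Rat.den_dvd X n
  exact hpx.trans (by exact_mod_cast this)

/-- `P` is divisible exactly once by the prime divisors of `N` and by no other prime, and `u` is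
a quadratic nonresidue modulo all of them. -/
def IsAdapted (N : ℕ) (P u : ℕ) : Prop :=
  0 < P ∧ 0 < u ∧ P ∣ N ∧
    ∀ p < N + 1, p.Prime → p ∣ N → p ∣ P ∧ ¬ p ^ 2 ∣ P ∧ ∀ k < p, k * k % p ≠ u % p

theorem exists_isAdapted {N : ℕ} (hN : Odd N) : ∃ P u, IsAdapted N P u := by
  have hN0 : N ≠ 0 := by rintro rfl; simp at hN
  have hnon : ∀ p : ℕ, p ∈ N.primeFactors → ∃ a : ℕ, ¬ IsSquare (a : ZMod p) := by
    intro p hp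
    have hpp := Nat.prime_of_mem_primeFactors hp
    have : Fact p.Prime := ⟨hpp⟩
    have hp2 : p ≠ 2 := by
      rintro rfl
      exact (Nat.not_even_iff_odd.2 hN) (even_iff_two_dvd.2 (Nat.dvd_of_mem_primeFactors hp))
    obtain ⟨a, ha⟩ := FiniteField.exists_nonsquare (F := ZMod p) (by rwa [ZMod.ringChar_zmod_n])
    exact ⟨a.val, by simpa using ha⟩
  choose! a ha using hnon
  obtain ⟨k, hk⟩ := Nat.chineseRemainderOfFinset a id N.primeFactors
    (fun p hp => (Nat.prime_of_mem_primeFactors hp).ne_zero)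
    (fun p hp q hq hpq => (Nat.coprime_primes (Nat.prime_of_mem_primeFactors hp)
      (Nat.prime_of_mem_primeFactors hq)).2 hpq)
  -- Adding N makes u positive without changing its residues modulo the divisors of N.
  refine ⟨∏ p ∈ N.primeFactors, p, k + N,
    Finset.prod_pos fun p hp => (Nat.prime_of_mem_primeFactors hp).pos, by omega,
    Nat.prod_primeFactors_dvd N, fun p _ hp hpN => ?_⟩
  have hmem : p ∈ N.primeFactors := Nat.mem_primeFactors.2 ⟨hp, hpN, hN0⟩
  have hdvd : p ∣ ∏ p ∈ N.primeFactors, p := Finset.dvd_prod_of_mem _ hmem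
  refine ⟨hdvd, ?_, ?_⟩
  · rw [← Finset.mul_prod_erase _ _ hmem, pow_two]
    intro h
    have h := Nat.dvd_of_mul_dvd_mul_left hp.pos h
    obtain ⟨q, hq, hpq⟩ := (hp.prime.dvd_finsetProd_iff _).1 h
    rw [Finset.mem_erase] at hq
    exact hq.1 ((Nat.prime_dvd_prime_iff_eq hp (Nat.prime_of_mem_primeFactors hq.2)).1 hpq).symm
  · intro l _ hl
    apply ha p hmem
    have h1 : l * l ≡ k + N [MOD p] := hl
    have h2 : k + N ≡ a p [MOD p] := by
      simpa using (hk p hmem).add ((Nat.modEq_zero_iff_dvd).2 hpN)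
    refine ⟨l, ?_⟩
    have := (ZMod.natCast_eq_natCast_iff _ _ _).2 (h1.trans h2)
    rw [← this]; push_cast; rfl

/-- Translates the bounded quantifiers of `IsAdapted`, which serve to make it primitive recursive,
into the form that the arithmetic uses. -/
theorem IsAdapted.spec {N P u : ℕ} (h : IsAdapted N P u) (hN : N ≠ 0) {p : ℕ} (hp : p.Prime)
    (hpN : p ∣ N) : p ∣ P ∧ ¬ p ^ 2 ∣ P ∧ ¬ IsSquare (u : ZMod p) := by
  obtain ⟨h₁, h₂, h₃⟩ := h.2.2.2 p (Nat.lt_succ_of_le (Nat.le_of_dvd (Nat.pos_of_ne_zero hN) hpN)) hp hpN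
  refine ⟨h₁, h₂, ?_⟩
  rintro ⟨k, hk⟩
  have : NeZero p := ⟨hp.ne_zero⟩
  refine h₃ k.val k.val_lt ?_
  refine (ZMod.natCast_eq_natCast_iff (k.val * k.val) u p).1 ?_
  rw [hk]; push_cast; simp

/-- A tuple of rational numbers has no denominators dividing the odd number `N` if and only if it
has a common certificate by norm one equations. -/
theorem forall_not_dvd_den_iff {N P u : ℕ} (hN : Odd N) (h : IsAdapted N P u) (K : ℕ) (x : ℕ → ℚ) :
    (∀ i < K, ∀ p : ℕ, p.Prime → p ∣ N → ¬ p ∣ (x i).den) ↔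
      ∃ (t D : ℚ) (s : ℕ → ℚ), D * (1 + P * t) = 1 ∧ QuaternionSolvable P u t ∧
        ∀ i < K, x i = s i * D ∧ QuaternionSolvable P u (s i) := by
  have hN0 : N ≠ 0 := by rintro rfl; simp at hN
  constructor
  · intro hx
    have hint : ∀ m : ℤ, QuaternionSolvable P u m := exists_quaternion_norm h.1 h.2.1
    set n := ∏ i ∈ Finset.range K, (x i).den with hn
    have hn0 : n ≠ 0 := Finset.prod_ne_zero_iff.2 fun i _ => (x i).den_nz
    have hcop : n.Coprime P := by
      refine Nat.Coprime.coprime_dvd_right h.2.2.1 ?_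
      rw [hn, Nat.coprime_prod_left_iff]
      intro i hi
      refine Nat.Coprime.symm (Nat.coprime_of_dvd fun p hp hpN hpd => ?_)
      exact hx i (Finset.mem_range.1 hi) p hp hpN hpd
    -- By Euler, a power of the common denominator has the form 1 + Pt with t an integer. Its
    -- inverse serves as D, and the numerators s i become integers.
    have htot : n ^ P.totient ≡ 1 [MOD P] := Nat.ModEq.pow_totient hcop
    obtain ⟨t, ht⟩ := (Nat.modEq_iff_dvd' (Nat.one_le_iff_ne_zero.2 (pow_ne_zero _ hn0))).1 htot.symm
    have ht' : (n : ℚ) ^ P.totient = 1 + P * t := by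
      have : n ^ P.totient = 1 + P * t := by
        have := Nat.one_le_iff_ne_zero.2 (pow_ne_zero P.totient hn0)
        omega
      exact_mod_cast congrArg (Nat.cast : ℕ → ℚ) this
    have hnQ : (n : ℚ) ≠ 0 := by exact_mod_cast hn0
    refine ⟨t, 1 / n ^ P.totient, fun i => x i * n ^ P.totient, ?_, ?_, ?_⟩
    · rw [← ht']; field_simp
    · exact_mod_cast hint t
    · intro i hi
      refine ⟨by field_simp, ?_⟩
      obtain ⟨m, hm⟩ : (x i).den ∣ n ^ P.totient :=
        (Finset.dvd_prod_of_mem _ (Finset.mem_range.2 hi)).trans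
          (dvd_pow_self n (Nat.totient_pos.2 h.1).ne')
      have : x i * n ^ P.totient = ((x i).num * m : ℤ) := by
        have hm' : (n : ℚ) ^ P.totient = (x i).den * m := by exact_mod_cast congrArg (Nat.cast : ℕ → ℚ) hm
        rw [hm', ← mul_assoc, Rat.mul_den_eq_num]; push_cast; rfl
      exact (congrArg _ this).mpr (hint _)
  · rintro ⟨t, D, s, hD, ht, hs⟩ i hi p hp hpN
    obtain ⟨hpP, hpP2, hu⟩ := h.spec hN0 hp hpN
    have hp2 : p ≠ 2 := by
      rintro rfl
      exact (Nat.not_even_iff_odd.2 hN) (even_iff_two_dvd.2 hpN)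
    obtain ⟨hxi, hsi⟩ := hs i hi
    have ht' := ht.not_dvd_den hp hp2 hpP hpP2 hu
    have hs' := hsi.not_dvd_den hp hp2 hpP hpP2 hu
    -- As t is p-integral and p ∣ P, the number 1 + Pt is a unit at p, so D is p-integral.
    have hD' : ¬ p ∣ D.den := by
      have htd : (t.den : ℚ) ≠ 0 := by exact_mod_cast t.den_nz
      have hne : (1 + P * t) ≠ 0 := right_ne_zero_of_mul_eq_one hD
      have hne' : (t.den + P * t.num : ℚ) ≠ 0 := by
        rw [← t.mul_den_eq_num]
        have : (t.den : ℚ) + P * (t * t.den) = t.den * (1 + P * t) := by ring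
        rw [this]; exact mul_ne_zero htd hne
      have hDe : D = ((t.den : ℤ) : ℚ) / ((t.den + P * t.num : ℤ) : ℚ) := by
        push_cast
        rw [eq_div_iff hne', ← t.mul_den_eq_num]
        linear_combination (t.den : ℚ) * hD
      have hdvd : (D.den : ℤ) ∣ t.den + P * t.num := by
        rw [hDe, ← Rat.divInt_eq_div]; exact Rat.den_dvd _ _
      intro hpd
      have h1 : (p : ℤ) ∣ t.den + P * t.num := (Int.natCast_dvd_natCast.2 hpd).trans hdvd
      have h2 : (p : ℤ) ∣ P * t.num := (Int.natCast_dvd_natCast.2 hpP).mul_right _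
      exact ht' (Int.natCast_dvd_natCast.1 ((dvd_add_left h2).1 h1))
    rw [hxi]
    intro hd
    rcases hp.dvd_mul.1 (hd.trans (Rat.mul_den_dvd _ _)) with h' | h'
    · exact hs' h'
    · exact hD' h'

/-! ### Primitive recursive operations on integers, lists and predicates -/

namespace Primrec

variable {α : Type*} [Primcodable α]

theorem int_ofNat : Primrec (Int.ofNat) :=
  Primrec.encode_iff.1 <| (Primrec.nat_mul.comp (Primrec.const 2) Primrec.id).of_eq fun _ => rfl

theorem int_negSucc : Primrec (Int.negSucc) :=
  Primrec.encode_iff.1 <| (Primrec.succ.comp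
    (Primrec.nat_mul.comp (Primrec.const 2) Primrec.id)).of_eq fun _ => rfl

theorem encode_int_ofNat (n : ℕ) : Encodable.encode (Int.ofNat n) = 2 * n := rfl

theorem encode_int_negSucc (n : ℕ) : Encodable.encode (Int.negSucc n) = 2 * n + 1 := rfl

theorem int_toNat : Primrec Int.toNat := by
  refine (Primrec.ite (c := fun z : ℤ => Encodable.encode z % 2 = 0) (Primrec.eq.comp
    (nat_mod.comp Primrec.encode (Primrec.const 2)) (Primrec.const 0))
    (nat_div.comp Primrec.encode (Primrec.const 2)) (Primrec.const 0)).of_eq fun z => ?_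
  cases z with
  | ofNat n => rw [encode_int_ofNat]; simp
  | negSucc n => rw [encode_int_negSucc]; simp

theorem int_toNat_neg : Primrec fun z : ℤ => (-z).toNat := by
  refine (Primrec.ite (c := fun z : ℤ => Encodable.encode z % 2 = 0) (Primrec.eq.comp
    (nat_mod.comp Primrec.encode (Primrec.const 2)) (Primrec.const 0))
    (Primrec.const 0)
    (nat_div.comp (Primrec.succ.comp Primrec.encode) (Primrec.const 2))).of_eq fun z => ?_
  cases z with
  | ofNat n => rw [encode_int_ofNat]; simp
  | negSucc n => rw [encode_int_negSucc, if_neg (by omega)]; simp; omega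

theorem int_natSub : Primrec₂ fun a b : ℕ => (a : ℤ) - b := by
  refine (Primrec.ite (nat_le.comp snd fst) (int_ofNat.comp (nat_sub.comp fst snd))
    (int_negSucc.comp (nat_sub.comp (nat_sub.comp snd fst) (Primrec.const 1)))).of_eq fun p => ?_
  simp only
  split_ifs with h
  · simp; omega
  · rw [Int.negSucc_eq]; omega

theorem int_natCast : Primrec fun n : ℕ => (n : ℤ) := int_ofNat

theorem int_add : Primrec₂ ((· + ·) : ℤ → ℤ → ℤ) := by
  refine (int_natSub.comp (nat_add.comp (int_toNat.comp fst) (int_toNat.comp snd))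
    (nat_add.comp (int_toNat_neg.comp fst) (int_toNat_neg.comp snd))).of_eq fun p => ?_
  simp only; omega

theorem int_mul : Primrec₂ ((· * ·) : ℤ → ℤ → ℤ) := by
  refine (int_natSub.comp
    (nat_add.comp (nat_mul.comp (int_toNat.comp fst) (int_toNat.comp snd))
      (nat_mul.comp (int_toNat_neg.comp fst) (int_toNat_neg.comp snd)))
    (nat_add.comp (nat_mul.comp (int_toNat.comp fst) (int_toNat_neg.comp snd))
      (nat_mul.comp (int_toNat_neg.comp fst) (int_toNat.comp snd)))).of_eq fun p => ?_
  obtain ⟨x, y⟩ := p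
  have hx : (x.toNat : ℤ) - ((-x).toNat : ℤ) = x := by omega
  have hy : (y.toNat : ℤ) - ((-y).toNat : ℤ) = y := by omega
  push_cast
  linear_combination ((y.toNat : ℤ) - ((-y).toNat : ℤ)) * hx + x * hy

theorem int_neg : Primrec fun z : ℤ => -z :=
  (int_mul.comp (Primrec.const (-1)) Primrec.id).of_eq fun z => by simp

theorem int_pow : Primrec₂ ((· ^ ·) : ℤ → ℕ → ℤ) := by
  refine (Primrec.nat_rec (f := fun _ : ℤ => (1 : ℤ)) (g := fun z p => p.2 * z) (Primrec.const 1)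
    (int_mul.comp (snd.comp snd) fst)).of_eq fun z n => ?_
  induction n with
  | zero => simp
  | succ n ih => simp only at ih ⊢; rw [pow_succ, ← ih]

theorem list_prod {M : Type*} [Primcodable M] [Monoid M]
    (h : Primrec₂ ((· * ·) : M → M → M)) : Primrec (List.prod : List M → M) :=
  (list_foldr (f := id) (g := fun _ => (1 : M)) (h := fun _ p => p.1 * p.2) Primrec.id
    (Primrec.const 1) (h.comp (fst.comp snd) (snd.comp snd))).of_eq fun l => by
      rw [List.prod_eq_foldr]; rfl

theorem list_sum {M : Type*} [Primcodable M] [AddMonoid M]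
    (h : Primrec₂ ((· + ·) : M → M → M)) : Primrec (List.sum : List M → M) :=
  (list_foldr (f := id) (g := fun _ => (0 : M)) (h := fun _ p => p.1 + p.2) Primrec.id
    (Primrec.const 0) (h.comp (fst.comp snd) (snd.comp snd))).of_eq fun l => by
      rw [List.sum_eq_foldr]; rfl

theorem list_replicate {β : Type*} [Primcodable β] (b : β) :
    Primrec fun n => List.replicate n b :=
  (list_map list_range (Primrec.const b).to₂).of_eq fun n => by simp

theorem denumerable_ofNat_terms :
    Primrec (Denumerable.ofNat (List (ℤ × List ℕ))) :=
  Primrec.encode_iff.1 <| Primrec.id.of_eq fun n => (Denumerable.encode_ofNat n).symm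

end Primrec

namespace PrimrecPred

theorem nat_dvd : PrimrecRel fun a b : ℕ => a ∣ b :=
  (Primrec.eq.comp (Primrec.nat_mod.comp Primrec.snd Primrec.fst) (Primrec.const 0)).of_eq
    fun _ => (Nat.dvd_iff_mod_eq_zero).symm

variable {α β : Type*} [Primcodable α] [Primcodable β]

theorem imp {p q : α → Prop} (hp : PrimrecPred p) (hq : PrimrecPred q) :
    PrimrecPred fun a => p a → q a :=
  (hp.not.or hq).of_eq fun _ => by tauto

theorem list_all {p : α → β → Prop} {f : α → List β} (hp : PrimrecRel p) (hf : Primrec f) :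
    PrimrecPred fun a => ∀ b ∈ f a, p a b :=
  (PrimrecRel.forall_mem_list (R := fun b a => p a b) (PrimrecRel.comp hp .snd .fst)).comp
    hf Primrec.id

theorem list_exists {p : α → β → Prop} {f : α → List β} (hp : PrimrecRel p) (hf : Primrec f) :
    PrimrecPred fun a => ∃ b ∈ f a, p a b :=
  (PrimrecRel.exists_mem_list (R := fun b a => p a b) (PrimrecRel.comp hp .snd .fst)).comp
    hf Primrec.id

theorem all_lt {p : α → ℕ → Prop} {f : α → ℕ} (hp : PrimrecRel p) (hf : Primrec f) :
    PrimrecPred fun a => ∀ b < f a, p a b :=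
  (list_all hp (Primrec.list_range.comp hf)).of_eq fun a => by simp

theorem exists_lt' {p : α → ℕ → Prop} {f : α → ℕ} (hp : PrimrecRel p) (hf : Primrec f) :
    PrimrecPred fun a => ∃ b < f a, p a b :=
  (list_exists hp (Primrec.list_range.comp hf)).of_eq fun a => by simp

theorem nat_prime : PrimrecPred Nat.Prime := by
  refine ((Primrec.nat_le.comp (Primrec.const 2) Primrec.id).and
    (all_lt (p := fun n m => 2 ≤ m → ¬ m ∣ n) (f := id) ?_ Primrec.id)).of_eq fun n => ?_
  · exact (imp (Primrec.nat_le.comp (Primrec.const 2) Primrec.snd)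
      (nat_dvd.comp Primrec.snd Primrec.fst).not)
  · rw [Nat.prime_def_lt']
    simp only [id]
    tauto

theorem list_filter {p : α → β → Prop} [DecidableRel p] {f : α → List β} (hp : PrimrecRel p)
    (hf : Primrec f) : Primrec fun a => (f a).filter fun b => p a b :=
  (PrimrecRel.listFilter (R := fun b a => p a b) (PrimrecRel.comp hp .snd .fst)).comp
    hf Primrec.id

end PrimrecPred

/-! ### Arithmetic of polynomials given as lists of terms -/

section Terms

variable {K : Type*} [CommRing K]

/-- The value of the monomial `X₀ ^ a₀ * ⋯ * Xₖ ^ aₖ` at `x`. -/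
def monoEval (x : ℕ → K) : List ℕ → K
  | [] => 1
  | a :: l => x 0 ^ a * monoEval (fun i => x (i + 1)) l

/-- The value of the polynomial presented by a list of terms. -/
def evalTerms (x : ℕ → K) (t : List (ℤ × List ℕ)) : K :=
  (t.map fun c => (c.1 : K) * monoEval x c.2).sum

theorem monoEval_eq_prod (x : ℕ → K) (l : List ℕ) {n : ℕ} (hn : l.length ≤ n) :
    monoEval x l = ∏ i ∈ Finset.range n, x i ^ l.getD i 0 := by
  induction l generalizing x n with
  | nil => simp [monoEval]
  | cons a l ih =>
    obtain ⟨n, rfl⟩ : ∃ m, n = m + 1 := ⟨n - 1, by simp at hn; omega⟩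
    rw [Finset.prod_range_succ', monoEval, ih _ (by simpa using hn), mul_comm]
    simp

theorem aeval_polyOfTerms (x : ℕ → K) (t : List (ℤ × List ℕ)) :
    MvPolynomial.aeval x (polyOfTerms t) = evalTerms x t := by
  rw [polyOfTerms, map_list_sum, List.map_map, evalTerms]
  congr 1
  apply List.map_congr_left
  rintro ⟨c, l⟩ -
  simp only [Function.comp, MvPolynomial.aeval_monomial, eq_intCast]
  congr 1
  rw [monoEval_eq_prod x l le_rfl]
  rw [Finsupp.prod_of_support_subset (s := Finset.range l.length)]
  · simp
  · intro i hi
    simp only [List.toFinsupp_support, Finset.mem_filter] at hi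
    exact hi.1
  · simp

theorem evalTerms_nil (x : ℕ → K) : evalTerms x [] = 0 := by simp [evalTerms]

theorem evalTerms_cons (x : ℕ → K) (c t) :
    evalTerms x (c :: t) = (c.1 : K) * monoEval x c.2 + evalTerms x t := by simp [evalTerms]

theorem evalTerms_append (x : ℕ → K) (t t') :
    evalTerms x (t ++ t') = evalTerms x t + evalTerms x t' := by simp [evalTerms]

/-- Sum of exponent vectors. -/
def addExp (l l' : List ℕ) : List ℕ :=
  (List.range (l.length + l'.length)).map fun i => l.getD i 0 + l'.getD i 0

theorem monoEval_addExp (x : ℕ → K) (l l') :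
    monoEval x (addExp l l') = monoEval x l * monoEval x l' := by
  rw [monoEval_eq_prod x l (Nat.le_add_right _ l'.length),
    monoEval_eq_prod x l' (Nat.le_add_left _ l.length),
    monoEval_eq_prod x (addExp l l') (n := l.length + l'.length) (by simp [addExp]),
    ← Finset.prod_mul_distrib]
  refine Finset.prod_congr rfl fun i hi => ?_
  rw [← pow_add]
  congr 1
  rw [Finset.mem_range] at hi
  simp [addExp, List.getD_eq_getElem?_getD, hi]

/-- Product of lists of terms. -/
def mulTerms (t t' : List (ℤ × List ℕ)) : List (ℤ × List ℕ) :=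
  t.flatMap fun c => t'.map fun c' => (c.1 * c'.1, addExp c.2 c'.2)

theorem evalTerms_mulTerms (x : ℕ → K) (t t') :
    evalTerms x (mulTerms t t') = evalTerms x t * evalTerms x t' := by
  induction t with
  | nil => simp [mulTerms, evalTerms_nil]
  | cons c t ih =>
    have : mulTerms (c :: t) t' =
      t'.map (fun c' => (c.1 * c'.1, addExp c.2 c'.2)) ++ mulTerms t t' := rfl
    rw [this, evalTerms_append, ih, evalTerms_cons, add_mul]
    congr 1
    simp only [evalTerms, List.map_map, Function.comp_def, monoEval_addExp]
    rw [← List.sum_map_mul_left]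
    congr 1
    apply List.map_congr_left
    intro c' _
    push_cast; ring

/-- The sum of the squares of some polynomials. -/
def sumSqTerms (L : List (List (ℤ × List ℕ))) : List (ℤ × List ℕ) :=
  L.flatMap fun t => mulTerms t t

/-- Over an ordered field squares are nonnegative, so a finite system collapses to a single
equation. -/
theorem evalTerms_sumSqTerms_eq_zero (x : ℕ → ℚ) (L : List (List (ℤ × List ℕ))) :
    evalTerms x (sumSqTerms L) = 0 ↔ ∀ t ∈ L, evalTerms x t = 0 := by
  have hnn : ∀ L : List (List (ℤ × List ℕ)), 0 ≤ evalTerms x (sumSqTerms L) := by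
    intro L
    induction L with
    | nil => simp [sumSqTerms, evalTerms_nil]
    | cons t L ih =>
      have : sumSqTerms (t :: L) = mulTerms t t ++ sumSqTerms L := rfl
      rw [this, evalTerms_append, evalTerms_mulTerms]
      exact add_nonneg (mul_self_nonneg _) ih
  induction L with
  | nil => simp [sumSqTerms, evalTerms_nil]
  | cons t L ih =>
    have : sumSqTerms (t :: L) = mulTerms t t ++ sumSqTerms L := rfl
    rw [this, evalTerms_append, evalTerms_mulTerms,
      add_eq_zero_iff_of_nonneg (mul_self_nonneg _) (hnn L), List.forall_mem_cons]
    exact and_congr mul_self_eq_zero ih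

/-- Rename each variable `Xᵢ` to `Xₖ₊ᵢ`. -/
def shiftTerms (k : ℕ) (t : List (ℤ × List ℕ)) : List (ℤ × List ℕ) :=
  t.map fun c => (c.1, List.replicate k 0 ++ c.2)

theorem monoEval_replicate (x : ℕ → K) (k : ℕ) (l : List ℕ) :
    monoEval x (List.replicate k 0 ++ l) = monoEval (fun i => x (k + i)) l := by
  induction k generalizing x with
  | zero => simp
  | succ k ih =>
    rw [List.replicate_succ, List.cons_append, monoEval, ih]
    simp only [pow_zero, one_mul, add_right_comm]

theorem evalTerms_shiftTerms (x : ℕ → K) (k : ℕ) (t) :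
    evalTerms x (shiftTerms k t) = evalTerms (fun i => x (k + i)) t := by
  simp [evalTerms, shiftTerms, Function.comp_def, monoEval_replicate]

theorem monoEval_mul_left (d : K) (x : ℕ → K) (l : List ℕ) :
    monoEval (fun i => d * x i) l = d ^ l.sum * monoEval x l := by
  induction l generalizing x with
  | nil => simp [monoEval]
  | cons a l ih =>
    rw [monoEval, monoEval, ih, List.sum_cons, pow_add, mul_pow]
    ring

/-- A bound for the total degree. -/
def degBound (t : List (ℤ × List ℕ)) : ℕ := (t.map fun c => c.2.sum).sum

/-- Homogenization, with a new variable in front. -/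
def homogTerms (t : List (ℤ × List ℕ)) : List (ℤ × List ℕ) :=
  t.map fun c => (c.1, (degBound t - c.2.sum) :: c.2)

theorem evalTerms_homogTerms (x y : ℕ → K) (t) (h : ∀ i, y (i + 1) = y 0 * x i) :
    evalTerms y (homogTerms t) = y 0 ^ degBound t * evalTerms x t := by
  unfold evalTerms homogTerms
  rw [← List.sum_map_mul_left, List.map_map]
  congr 1
  apply List.map_congr_left
  intro c hc
  have hle : c.2.sum ≤ degBound t := List.le_sum_of_mem (List.mem_map_of_mem hc)
  simp only [Function.comp, monoEval, h, monoEval_mul_left]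
  rw [← Nat.sub_add_cancel hle, pow_add, Nat.add_sub_cancel]
  ring

/-- Multiply every variable by the new variable `X₀` and spread the variables, `Xᵢ` becoming
`X₀ * X₅₊₄ᵢ`. -/
def spreadTerms (t : List (ℤ × List ℕ)) : List (ℤ × List ℕ) :=
  t.map fun c => (c.1, c.2.sum :: ([0, 0, 0, 0] ++ c.2.flatMap fun a => [a, 0, 0, 0]))

theorem monoEval_spread (x : ℕ → K) (l : List ℕ) :
    monoEval x (l.flatMap fun a => [a, 0, 0, 0]) = monoEval (fun i => x (4 * i)) l := by
  induction l generalizing x with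
  | nil => simp [monoEval]
  | cons a l ih =>
    simp only [List.flatMap_cons, List.cons_append, List.nil_append, monoEval, pow_zero, one_mul, ih,
      mul_zero]
    rfl

theorem evalTerms_spreadTerms (y : ℕ → K) (t) :
    evalTerms y (spreadTerms t) = evalTerms (fun i => y 0 * y (5 + 4 * i)) t := by
  unfold evalTerms spreadTerms
  rw [List.map_map]
  congr 1
  apply List.map_congr_left
  intro c _
  simp only [Function.comp, monoEval, monoEval_mul_left, List.cons_append, List.nil_append,
    monoEval_spread, pow_zero, one_mul]
  congr 4
  ext i
  congr 1
  ring

/-- A bound for the number of variables. -/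
def varBound (t : List (ℤ × List ℕ)) : ℕ := (t.map fun c => c.2.length).sum

theorem evalTerms_congr {x y : ℕ → K} {t} (h : ∀ i < varBound t, x i = y i) :
    evalTerms x t = evalTerms y t := by
  unfold evalTerms
  congr 1
  apply List.map_congr_left
  intro c hc
  have hle : c.2.length ≤ varBound t := List.le_sum_of_mem (List.mem_map_of_mem hc)
  rw [monoEval_eq_prod x _ hle, monoEval_eq_prod y _ hle]
  congr 1
  exact Finset.prod_congr rfl fun i hi => by rw [h i (Finset.mem_range.1 hi)]

theorem map_evalTerms {L : Type*} [CommRing L] (f : K →+* L) (x : ℕ → K) (t) :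
    f (evalTerms x t) = evalTerms (fun i => f (x i)) t := by
  unfold evalTerms
  rw [map_list_sum, List.map_map]
  congr 1
  apply List.map_congr_left
  intro c _
  simp [monoEval_eq_prod _ c.2 le_rfl, map_prod]

end Terms

/-! ### Primitive recursiveness of the operations on terms -/

section TermsPrimrec

open Primrec

variable {α : Type*} [Primcodable α]

theorem primrec_addExp : Primrec₂ addExp :=
  list_map (list_range.comp (nat_add.comp (list_length.comp fst) (list_length.comp snd)))
    (nat_add.comp ((list_getD 0).comp (fst.comp fst) snd) ((list_getD 0).comp (snd.comp fst) snd))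

theorem primrec_mulTerms : Primrec₂ mulTerms :=
  list_flatMap fst <| list_map (snd.comp fst) <|
    Primrec.pair (int_mul.comp (fst.comp (snd.comp fst)) (fst.comp snd))
      (primrec_addExp.comp (snd.comp (snd.comp fst)) (snd.comp snd))

theorem primrec_sumSqTerms : Primrec sumSqTerms :=
  list_flatMap Primrec.id (primrec_mulTerms.comp snd snd)

theorem primrec_shiftTerms : Primrec₂ shiftTerms :=
  list_map snd <| Primrec.pair (fst.comp snd)
    (list_append.comp ((list_replicate 0).comp (fst.comp fst)) (snd.comp snd))

theorem primrec_degBound : Primrec degBound :=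
  (list_sum nat_add).comp (list_map Primrec.id ((list_sum nat_add).comp (snd.comp snd)))

theorem primrec_varBound : Primrec varBound :=
  (list_sum nat_add).comp (list_map Primrec.id (list_length.comp (snd.comp snd)))

theorem primrec_homogTerms : Primrec homogTerms :=
  list_map Primrec.id <| Primrec.pair (fst.comp snd) <|
    list_cons.comp (nat_sub.comp (primrec_degBound.comp fst)
      ((list_sum nat_add).comp (snd.comp snd))) (snd.comp snd)

theorem primrec_spreadTerms : Primrec spreadTerms :=
  list_map Primrec.id <| Primrec.pair (fst.comp snd) <|
    list_cons.comp ((list_sum nat_add).comp (snd.comp snd)) <|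
      list_append.comp (Primrec.const [0, 0, 0, 0]) <| list_flatMap (snd.comp snd)
        (list_cons.comp snd (Primrec.const [0, 0, 0]))

/-- Evaluation at a list of integers, continued by zero. -/
theorem primrec_evalTerms : Primrec₂ fun (b : List ℤ) t => evalTerms (fun i => b.getD i 0) t := by
  have hmono : Primrec₂ fun (b : List ℤ) l => monoEval (fun i => b.getD i 0) l := by
    refine ((list_prod int_mul).comp (list_map (list_range.comp (list_length.comp snd))
      (int_pow.comp ((list_getD 0).comp (fst.comp fst) snd)
        ((list_getD 0).comp (snd.comp fst) snd)).to₂)).of_eq fun p => ?_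
    exact (monoEval_eq_prod (fun i => p.1.getD i 0) p.2 le_rfl).symm
  refine ((list_sum int_add).comp (list_map snd (int_mul.comp (fst.comp snd)
    (hmono.comp (fst.comp fst) (snd.comp snd))).to₂)).of_eq fun p => ?_
  simp [evalTerms]

end TermsPrimrec

/-! ### Finite certificates for solvability in subrings of ℚ -/

theorem mem_invertPrimes_iff {S : Set ℕ} (hS : 0 ∉ S) {x : ℚ} :
    x ∈ invertPrimes S ↔ ∃ g : List ℕ, (∀ v ∈ g, v ∈ S) ∧ ∃ m : ℤ, x * (g.prod : ℕ) = m := by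
  constructor
  · intro hx
    induction hx using Subring.closure_induction with
    | mem x hx =>
      obtain ⟨p, hp, rfl⟩ := hx
      have : (p : ℚ) ≠ 0 := by
        rintro h
        exact hS ((Nat.cast_eq_zero.1 h) ▸ hp)
      exact ⟨[p], by simpa using hp, 1, by simp [this]⟩
    | zero => exact ⟨[], by simp, 0, by simp⟩
    | one => exact ⟨[], by simp, 1, by simp⟩
    | add x y _ _ hx hy =>
      obtain ⟨g, hg, m, hm⟩ := hx
      obtain ⟨g', hg', m', hm'⟩ := hy
      refine ⟨g ++ g', fun v hv => (List.mem_append.1 hv).elim (hg v) (hg' v),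
        m * g'.prod + m' * g.prod, ?_⟩
      rw [List.prod_append]
      generalize g.prod = G at *
      generalize g'.prod = G' at *
      push_cast
      linear_combination (G' : ℚ) * hm + (G : ℚ) * hm'
    | neg x _ hx =>
      obtain ⟨g, hg, m, hm⟩ := hx
      exact ⟨g, hg, -m, by rw [neg_mul, hm, Int.cast_neg]⟩
    | mul x y _ _ hx hy =>
      obtain ⟨g, hg, m, hm⟩ := hx
      obtain ⟨g', hg', m', hm'⟩ := hy
      refine ⟨g ++ g', fun v hv => (List.mem_append.1 hv).elim (hg v) (hg' v), m * m', ?_⟩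
      rw [List.prod_append]
      generalize g.prod = G at *
      generalize g'.prod = G' at *
      push_cast
      linear_combination (y * G' : ℚ) * hm + (m : ℚ) * hm'
  · rintro ⟨g, hg, m, hm⟩
    have hprod : ((g.prod : ℕ) : ℚ)⁻¹ ∈ invertPrimes S := by
      clear hm
      induction g with
      | nil => simp
      | cons v g ih =>
        rw [List.prod_cons, Nat.cast_mul, mul_inv]
        exact mul_mem (Subring.subset_closure ⟨v, hg v (by simp), rfl⟩)
          (ih fun w hw => hg w (by simp [hw]))
    have hne : ((g.prod : ℕ) : ℚ) ≠ 0 := by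
      rw [Nat.cast_ne_zero, Ne, List.prod_eq_zero_iff]
      exact fun h => hS (hg 0 h)
    rw [(eq_mul_inv_iff_mul_eq₀ hne).2 hm]
    exact mul_mem (intCast_mem _ m) hprod

theorem mem_invertPrimes_not_dvd_iff {N : ℕ} {x : ℚ} :
    x ∈ invertPrimes {p | p.Prime ∧ ¬ p ∣ N} ↔ ∀ p : ℕ, p.Prime → p ∣ N → ¬ p ∣ x.den := by
  rw [mem_invertPrimes_iff (by simp [Nat.not_prime_zero])]
  constructor
  · rintro ⟨g, hg, m, hm⟩ p hp hpN hpx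
    have hne : ((g.prod : ℕ) : ℚ) ≠ 0 := by
      rw [Nat.cast_ne_zero, Ne, List.prod_eq_zero_iff]
      exact fun h => Nat.not_prime_zero (hg 0 h).1
    have hx : x = Rat.divInt m (g.prod : ℕ) := by
      rw [Rat.divInt_eq_div, Int.cast_natCast, eq_div_iff hne, hm]
    have hd : (x.den : ℤ) ∣ (g.prod : ℕ) := by rw [hx]; exact Rat.den_dvd _ _
    obtain ⟨v, hv, hpv⟩ := (hp.prime.dvd_prod_iff).1 (hpx.trans (Int.natCast_dvd_natCast.1 hd))
    obtain ⟨hv1, hv2⟩ := hg v hv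
    exact hv2 ((Nat.prime_dvd_prime_iff_eq hp hv1).1 hpv ▸ hpN)
  · intro h
    refine ⟨x.den.primeFactorsList, fun v hv => ⟨Nat.prime_of_mem_primeFactorsList hv, fun hvN =>
      h v (Nat.prime_of_mem_primeFactorsList hv) hvN (Nat.dvd_of_mem_primeFactorsList hv)⟩, x.num, ?_⟩
    rw [Nat.prod_primeFactorsList x.den_nz, Rat.mul_den_eq_num]

/-- The list of terms with a given index. -/
def termsOf (e : ℕ) : List (ℤ × List ℕ) := Denumerable.ofNat (List (ℤ × List ℕ)) e

theorem termsOf_encode (t : List (ℤ × List ℕ)) : termsOf (Encodable.encode t) = t :=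
  Denumerable.ofNat_encode t

theorem mem_HTP_iff {R : Type*} [CommRing R] {e : ℕ} :
    e ∈ HTP R ↔ ∃ x : ℕ → R, evalTerms x (termsOf e) = 0 := by
  simp only [HTP, polyEnum, Set.mem_ofPred_eq, aeval_polyOfTerms, termsOf]

theorem mem_HTP_subring_iff {R : Subring ℚ} {e : ℕ} :
    e ∈ HTP R ↔ ∃ x : ℕ → ℚ, (∀ i < varBound (termsOf e), x i ∈ R) ∧
      evalTerms x (termsOf e) = 0 := by
  rw [mem_HTP_iff]
  constructor
  · rintro ⟨x, hx⟩
    refine ⟨fun i => x i, fun i _ => (x i).2, ?_⟩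
    have := map_evalTerms R.subtype x (termsOf e)
    rw [hx, map_zero] at this
    exact this.symm
  · rintro ⟨x, hx, h⟩
    classical
    refine ⟨fun i => if hi : i < varBound (termsOf e) then ⟨x i, hx i hi⟩ else 0, ?_⟩
    apply R.subtype_injective
    rw [map_evalTerms, map_zero, ← h]
    refine evalTerms_congr fun i hi => ?_
    simp [hi]

/-- The list of numbers inverted in the candidate solution coded by `w`. -/
def witnessBase (w : ℕ) : List ℕ := (Denumerable.ofNat (List ℤ × List ℕ) w).2

/-- The candidate solution coded by `w` is a solution of the `e`-th polynomial. -/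
def IsWitness (e w : ℕ) : Prop :=
  evalTerms (fun i => (((witnessBase w).prod : ℤ) ::
    (Denumerable.ofNat (List ℤ × List ℕ) w).1).getD i 0) (homogTerms (termsOf e)) = 0

/-- Write a root over a common denominator that is a product of elements of S, and homogenize. The
result is a primitive recursive check on a code; S enters only through the finitely many listed
factors, which is what the priority construction exploits. -/
theorem mem_HTP_invertPrimes_iff {S : Set ℕ} (hS : 0 ∉ S) {e : ℕ} :
    e ∈ HTP (invertPrimes S) ↔ ∃ w, IsWitness e w ∧ ∀ v ∈ witnessBase w, v ∈ S := by
  rw [mem_HTP_subring_iff]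
  set T := termsOf e with hT
  have hcast : ∀ (y : ℕ → ℤ), evalTerms y (homogTerms T) = 0 ↔
      evalTerms (fun i => (y i : ℚ)) (homogTerms T) = 0 := by
    intro y
    have := map_evalTerms (Int.castRingHom ℚ) y (homogTerms T)
    simp only [eq_intCast] at this
    rw [← this, Int.cast_eq_zero]
  constructor
  · rintro ⟨x, hx, h⟩
    have hcommon : ∀ K, (∀ i < K, x i ∈ invertPrimes S) → ∃ g : List ℕ, (∀ v ∈ g, v ∈ S) ∧
        ∀ i < K, ∃ m : ℤ, (g.prod : ℕ) * x i = m := by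
      intro K
      induction K with
      | zero => exact fun _ => ⟨[], by simp, by simp⟩
      | succ K ih =>
        intro hK
        obtain ⟨g, hg, hm⟩ := ih fun i hi => hK i (by omega)
        obtain ⟨g', hg', m', hm'⟩ := (mem_invertPrimes_iff hS).1 (hK K (by omega))
        refine ⟨g ++ g', fun v hv => (List.mem_append.1 hv).elim (hg v) (hg' v), fun i hi => ?_⟩
        rw [List.prod_append]
        generalize g.prod = G at *
        generalize g'.prod = G' at *
        rcases Nat.lt_succ_iff_lt_or_eq.1 hi with hi | rfl
        · obtain ⟨m, hm⟩ := hm i hi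
          exact ⟨G' * m, by push_cast; linear_combination (G' : ℚ) * hm⟩
        · exact ⟨G * m', by push_cast; linear_combination (G : ℚ) * hm'⟩
    obtain ⟨g, hg, hm⟩ := hcommon _ hx
    choose! m hm using hm
    refine ⟨Encodable.encode ((List.range (varBound T)).map m, g), ?_, ?_⟩
    · simp only [IsWitness, witnessBase, Denumerable.ofNat_encode]
      -- Beyond the end of the coded list `getD` returns 0, so x is truncated to match; the
      -- polynomial does not see the change.
      rw [hcast, evalTerms_homogTerms (fun i => if i < varBound T then x i else 0)]
      · rw [evalTerms_congr (y := x) (fun i hi => by simp [hi]), h, mul_zero]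
      · intro i
        by_cases hi : i < varBound T
        · simp only [List.getD_cons_succ, List.getD_cons_zero, Int.cast_natCast, if_pos hi, hm i hi]
          simp [List.getD_eq_getElem?_getD, hi]
        · simp [List.getD_eq_getElem?_getD, hi]
    · simpa [witnessBase] using hg
  · rintro ⟨w, hw, hS'⟩
    have hne : (((witnessBase w).prod : ℕ) : ℚ) ≠ 0 := by
      rw [Nat.cast_ne_zero, Ne, List.prod_eq_zero_iff]
      exact fun h => hS (hS' 0 h)
    rw [IsWitness, hcast] at hw
    set b := (Denumerable.ofNat (List ℤ × List ℕ) w).1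
    refine ⟨fun i => b.getD i 0 / (witnessBase w).prod, fun i _ => ?_, ?_⟩
    · rw [mem_invertPrimes_iff hS]
      exact ⟨_, hS', b.getD i 0, by field_simp⟩
    · rw [evalTerms_homogTerms (fun i => (b.getD i 0 : ℚ) / (witnessBase w).prod)] at hw
      · refine (mul_eq_zero.1 hw).resolve_left (pow_ne_zero _ ?_)
        simpa using hne
      · intro i
        simp only [List.getD_cons_succ, List.getD_cons_zero]
        rw [Int.cast_natCast]
        field_simp

theorem primrec_termsOf : Primrec termsOf := Primrec.denumerable_ofNat_terms

theorem primrec_decodeWitness : Primrec (Denumerable.ofNat (List ℤ × List ℕ)) :=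
  Primrec.encode_iff.1 <| Primrec.id.of_eq fun n => (Denumerable.encode_ofNat n).symm

theorem primrec_witnessBase : Primrec witnessBase := Primrec.snd.comp primrec_decodeWitness

theorem primrecRel_isWitness : PrimrecRel IsWitness :=
  Primrec.eq.comp (primrec_evalTerms.comp
    (Primrec.list_cons.comp (Primrec.int_natCast.comp ((Primrec.list_prod Primrec.nat_mul).comp
      (primrec_witnessBase.comp Primrec.snd)))
      (Primrec.fst.comp (primrec_decodeWitness.comp Primrec.snd)) |>.of_eq fun p => by
        push_cast; rfl)
    (primrec_homogTerms.comp (primrec_termsOf.comp Primrec.fst))) (Primrec.const 0)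

/-! ### Reductions between ℚ and its subrings -/

/-- The polynomial `X₄ - 1 - X₀² - X₁² - X₂² - X₃²`. -/
def fourSquaresTerms : List (ℤ × List ℕ) :=
  [(1, [0, 0, 0, 0, 1]), (-1, []), (-1, [2]), (-1, [0, 2]), (-1, [0, 0, 2]), (-1, [0, 0, 0, 2])]

theorem evalTerms_fourSquaresTerms (y : ℕ → ℚ) :
    evalTerms y fourSquaresTerms = y 4 - 1 - y 0 ^ 2 - y 1 ^ 2 - y 2 ^ 2 - y 3 ^ 2 := by
  simp [evalTerms, fourSquaresTerms, monoEval]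
  ring

/-- The index of a polynomial that has a root in a subring of `ℚ` if and only if the `e`-th one
has a root in `ℚ`. -/
def clearDenominators (e : ℕ) : ℕ :=
  Encodable.encode (sumSqTerms [shiftTerms 4 (homogTerms (termsOf e)), fourSquaresTerms])

theorem primrec_clearDenominators : Primrec clearDenominators :=
  Primrec.encode.comp <| primrec_sumSqTerms.comp <| Primrec.list_cons.comp
    (primrec_shiftTerms.comp (Primrec.const 4) (primrec_homogTerms.comp primrec_termsOf))
    (Primrec.const [fourSquaresTerms])

/-- A root in R has X₄ > 0 by the second equation, so the remaining coordinates may be divided by X₄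
to give a rational root. Conversely, a rational root with common denominator d gives an integral
one, as d - 1 is a sum of four squares. -/
theorem clearDenominators_mem_HTP_iff {R : Subring ℚ} {e : ℕ} :
    clearDenominators e ∈ HTP R ↔ e ∈ HTP ℚ := by
  rw [mem_HTP_subring_iff, mem_HTP_iff, clearDenominators, termsOf_encode]
  simp only [evalTerms_sumSqTerms_eq_zero, List.mem_cons, List.not_mem_nil, or_false,
    forall_eq_or_imp, forall_eq, evalTerms_shiftTerms, evalTerms_fourSquaresTerms]
  set T := termsOf e
  constructor
  · rintro ⟨y, -, h₁, h₂⟩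
    have hpos : 0 < y 4 := by
      nlinarith [sq_nonneg (y 0), sq_nonneg (y 1), sq_nonneg (y 2), sq_nonneg (y 3)]
    refine ⟨fun i => y (4 + (i + 1)) / y 4, ?_⟩
    rw [evalTerms_homogTerms (fun i => y (4 + (i + 1)) / y 4)
      (fun i => y (4 + i)) _ (fun i => by field_simp)] at h₁
    exact (mul_eq_zero.1 h₁).resolve_left (pow_ne_zero _ hpos.ne')
  · rintro ⟨x, hx⟩
    set d := ∏ i ∈ Finset.range (varBound T), (x i).den with hd
    have hd0 : d ≠ 0 := Finset.prod_ne_zero_iff.2 fun i _ => (x i).den_nz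
    obtain ⟨a, b, c, f, habcf⟩ := Nat.sum_four_squares (d - 1)
    have hint : ∀ i < varBound T, ∃ m : ℤ, (d : ℚ) * x i = m := by
      intro i hi
      obtain ⟨k, hk⟩ := Finset.dvd_prod_of_mem (fun i => (x i).den) (Finset.mem_range.2 hi)
      refine ⟨k * (x i).num, ?_⟩
      rw [hd, hk]; push_cast
      linear_combination (k : ℚ) * (x i).mul_den_eq_num
    choose! m hm using hint
    -- The four squares occupy the first slots, the common denominator slot 4, and the numerators
    -- follow.
    let z : ℕ → ℤ := fun i => match i with
      | 0 => a | 1 => b | 2 => c | 3 => f | 4 => d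
      | i + 5 => if i < varBound T then m i else 0
    refine ⟨fun i => z i, fun i _ => intCast_mem _ _, ?_, ?_⟩
    · rw [evalTerms_homogTerms (fun i => if i < varBound T then x i else 0),
        evalTerms_congr (y := x) (fun i hi => by simp [hi]), hx, mul_zero]
      intro i
      have : 4 + (i + 1) = i + 5 := by omega
      rw [this]
      by_cases hi : i < varBound T
      · simp [z, hi, hm]
      · simp [z, hi]
    · have h : d = a ^ 2 + b ^ 2 + c ^ 2 + f ^ 2 + 1 := by omega
      simp only [z]
      push_cast
      rw [h]; push_cast; ring

/-- The polynomial `1 + 4Pu²X₀² - X₁² + uX₂² - PuX₃²`. -/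
def quaternionTerms (P u : ℕ) : List (ℤ × List ℕ) :=
  [(1, []), ((4 * P * u * u : ℕ), [2]), (-1, [0, 2]), ((u : ℕ), [0, 0, 2]),
    (-((P * u : ℕ) : ℤ), [0, 0, 0, 2])]

theorem evalTerms_quaternionTerms (P u : ℕ) (y : ℕ → ℚ) :
    evalTerms y (quaternionTerms P u) =
      1 + 4 * P * u ^ 2 * y 0 ^ 2 - (y 1 ^ 2 - u * y 2 ^ 2 + P * u * y 3 ^ 2) := by
  simp [evalTerms, quaternionTerms, monoEval]
  ring

/-- The polynomial `X₀ + PX₀X₁ - 1`. -/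
def unitTerms (P : ℕ) : List (ℤ × List ℕ) := [(1, [1]), ((P : ℕ), [1, 1]), (-1, [])]

theorem evalTerms_unitTerms (P : ℕ) (y : ℕ → ℚ) :
    evalTerms y (unitTerms P) = y 0 * (1 + P * y 1) - 1 := by
  simp [evalTerms, unitTerms, monoEval]
  ring

/-- The equations that express solvability in a semilocal subring. -/
def semilocalTerms (t : List (ℤ × List ℕ)) (P u : ℕ) : List (List (ℤ × List ℕ)) :=
  unitTerms P :: spreadTerms t :: (List.range (varBound t + 1)).map
    fun m => shiftTerms (1 + 4 * m) (quaternionTerms P u)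

/-- This is `forall_not_dvd_den_iff` written as a polynomial system. X₀ holds D, and the block of
four variables from 1 + 4m on holds an argument of `QuaternionSolvable` with its a, b, d. Block 0
belongs to t and block i + 1 to s i, so the i-th unknown is X₀ * X₅₊₄ᵢ. -/
theorem exists_semilocalTerms_iff {N P u : ℕ} (hN : Odd N) (h : IsAdapted N P u) (e : ℕ) :
    (∃ y : ℕ → ℚ, ∀ t ∈ semilocalTerms (termsOf e) P u, evalTerms y t = 0) ↔
      e ∈ HTP (invertPrimes {p | p.Prime ∧ ¬ p ∣ N}) := by
  rw [mem_HTP_subring_iff]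
  set T := termsOf e
  simp only [mem_invertPrimes_not_dvd_iff, forall_not_dvd_den_iff hN h, semilocalTerms,
    List.forall_mem_cons, List.mem_map, List.mem_range, forall_exists_index, and_imp,
    forall_apply_eq_imp_iff₂, evalTerms_unitTerms, evalTerms_spreadTerms, evalTerms_shiftTerms,
    evalTerms_quaternionTerms, Nat.lt_succ_iff]
  constructor
  · rintro ⟨y, h₁, h₂, h₃⟩
    have hQ : ∀ m ≤ varBound T, QuaternionSolvable P u (y (1 + 4 * m)) := fun m hm =>
      ⟨_, _, _, sub_eq_zero.1 (h₃ m hm)⟩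
    refine ⟨fun i => y 0 * y (5 + 4 * i), ⟨y 1, y 0, fun i => y (5 + 4 * i),
      sub_eq_zero.1 h₁, hQ 0 (Nat.zero_le _), fun i hi => ⟨mul_comm _ _, ?_⟩⟩, h₂⟩
    have := hQ (i + 1) hi
    rwa [show 1 + 4 * (i + 1) = 5 + 4 * i by ring] at this
  · rintro ⟨x, ⟨t, D, s, hD, ht, hs⟩, hx⟩
    let r : ℕ → ℚ := fun m => if m = 0 then t else s (m - 1)
    have hr : ∀ m ≤ varBound T, QuaternionSolvable P u (r m) := by
      intro m hm
      by_cases h0 : m = 0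
      · simpa [r, h0] using ht
      · simpa [r, h0] using (hs (m - 1) (by omega)).2
    choose! a b d habd using hr
    let y : ℕ → ℚ := fun i => if i = 0 then D else
      if (i - 1) % 4 = 0 then r ((i - 1) / 4) else if (i - 1) % 4 = 1 then a ((i - 1) / 4) else
      if (i - 1) % 4 = 2 then b ((i - 1) / 4) else d ((i - 1) / 4)
    have hy0 : y 0 = D := rfl
    have hyr : ∀ m, y (1 + 4 * m + 0) = r m := fun m => by simp [y]
    have hya : ∀ m, y (1 + 4 * m + 1) = a m := fun m => by
      have h1 : 1 + 4 * m + 1 - 1 = 4 * m + 1 := by omega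
      have h2 : (4 * m + 1) / 4 = m := by omega
      simp [y, h1, h2, Nat.add_mod]
    have hyb : ∀ m, y (1 + 4 * m + 2) = b m := fun m => by
      have h1 : 1 + 4 * m + 2 - 1 = 4 * m + 2 := by omega
      have h2 : (4 * m + 2) / 4 = m := by omega
      simp [y, h1, h2, Nat.add_mod]
    have hyd : ∀ m, y (1 + 4 * m + 3) = d m := fun m => by
      have h1 : 1 + 4 * m + 3 - 1 = 4 * m + 3 := by omega
      have h2 : (4 * m + 3) / 4 = m := by omega
      simp [y, h1, h2, Nat.add_mod]
    refine ⟨y, ?_, ?_, ?_⟩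
    · have := hyr 0
      rw [hy0, show y 1 = t from this, hD, sub_self]
    · rw [← hx]
      refine evalTerms_congr fun i hi => ?_
      have := hyr (i + 1)
      rw [hy0, show 5 + 4 * i = 1 + 4 * (i + 1) + 0 by ring, this, (hs i hi).1]
      simp [r, mul_comm]
    · intro m hm
      rw [hyr, hya, hyb, hyd, habd m hm, sub_self]

theorem primrecPred_isAdapted :
    PrimrecPred fun p : ℕ × ℕ => IsAdapted (2 * p.1 + 1) p.2.unpair.1 p.2.unpair.2 := by
  open Primrec in
  have hN : Primrec fun p : ℕ × ℕ => 2 * p.1 + 1 := nat_double_succ.comp fst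
  have hP : Primrec fun p : ℕ × ℕ => p.2.unpair.1 := fst.comp (unpair.comp snd)
  have hu : Primrec fun p : ℕ × ℕ => p.2.unpair.2 := snd.comp (unpair.comp snd)
  refine (nat_lt.comp (const 0) hP).and <| (nat_lt.comp (const 0) hu).and <|
    (PrimrecPred.nat_dvd.comp hP hN).and <| PrimrecPred.all_lt ?_ (succ.comp hN)
  refine PrimrecPred.imp (PrimrecPred.nat_prime.comp snd) <|
    PrimrecPred.imp (PrimrecPred.nat_dvd.comp snd (hN.comp fst)) <|
    (PrimrecPred.nat_dvd.comp snd (hP.comp fst)).and <| PrimrecPred.and ?_ ?_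
  · exact ((PrimrecPred.nat_dvd.comp (nat_mul.comp snd snd) (hP.comp fst)).not).of_eq
      fun _ => by rw [pow_two]
  · refine PrimrecPred.all_lt (p := fun (a : (ℕ × ℕ) × ℕ) k =>
      k * k % a.2 ≠ a.1.2.unpair.2 % a.2) ?_ snd
    exact (Primrec.eq.comp (nat_mod.comp (nat_mul.comp snd snd) (snd.comp fst))
      (nat_mod.comp (hu.comp (fst.comp fst)) (snd.comp fst))).not

theorem primrec_semilocalTerms :
    Primrec fun p : ℕ × ℕ × ℕ => semilocalTerms (termsOf p.1) p.2.1 p.2.2 := by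
  open Primrec in
  have ht : Primrec fun p : ℕ × ℕ × ℕ => termsOf p.1 := primrec_termsOf.comp fst
  have hP : Primrec fun p : ℕ × ℕ × ℕ => p.2.1 := fst.comp snd
  have hu : Primrec fun p : ℕ × ℕ × ℕ => p.2.2 := snd.comp snd
  have hunit : Primrec fun p : ℕ × ℕ × ℕ => unitTerms p.2.1 :=
    list_cons.comp (const (1, [1])) <| list_cons.comp
      (Primrec.pair (int_natCast.comp hP) (const [1, 1])) (const [(-1, [])])
  have hquat : Primrec fun p : ℕ × ℕ × ℕ => quaternionTerms p.2.1 p.2.2 :=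
    list_cons.comp (const (1, [])) <| list_cons.comp
      (Primrec.pair (int_natCast.comp (nat_mul.comp (nat_mul.comp (nat_mul.comp (const 4) hP) hu) hu))
        (const [2])) <|
      list_cons.comp (const (-1, [0, 2])) <| list_cons.comp
      (Primrec.pair (int_natCast.comp hu) (const [0, 0, 2])) <| list_cons.comp
      (Primrec.pair (int_neg.comp (int_natCast.comp (nat_mul.comp hP hu))) (const [0, 0, 0, 2]))
      (const [])
  exact list_cons.comp hunit <| list_cons.comp (primrec_spreadTerms.comp ht) <|
    list_map (list_range.comp (succ.comp (primrec_varBound.comp ht)))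
      (primrec_shiftTerms.comp (nat_add.comp (const 1) (nat_mul.comp (const 4) snd))
        (hquat.comp fst)).to₂

/-- The index of a polynomial that expresses solvability in a semilocal subring. -/
def semilocalIndex (p : ℕ × ℕ × ℕ) : ℕ :=
  Encodable.encode (sumSqTerms (semilocalTerms (termsOf p.1) p.2.1 p.2.2))

theorem primrec_semilocalIndex : Primrec semilocalIndex :=
  Primrec.encode.comp (primrec_sumSqTerms.comp primrec_semilocalTerms)

/-- Hilbert's Tenth Problem over the semilocal subrings of `ℚ` at finite sets of odd primes is
uniformly many-one reducible to the one over `ℚ`. -/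
theorem exists_semilocal_reduction : ∃ f : ℕ → ℕ, Computable f ∧ ∀ e n,
    f (Nat.pair e n) ∈ HTP ℚ ↔ e ∈ HTP (invertPrimes {p | p.Prime ∧ ¬ p ∣ 2 * n + 1}) := by
  classical
  have hex : ∀ n : ℕ, ∃ c : ℕ, IsAdapted (2 * n + 1) c.unpair.1 c.unpair.2 := fun n => by
    obtain ⟨P, u, h⟩ := exists_isAdapted (odd_two_mul_add_one n)
    exact ⟨Nat.pair P u, by simpa using h⟩
  obtain ⟨F, hF, hFs⟩ : ∃ F : ℕ → ℕ, Computable F ∧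
      ∀ n, IsAdapted (2 * n + 1) (F n).unpair.1 (F n).unpair.2 :=
    ⟨_, Computable.find primrecPred_isAdapted.computablePred hex, fun n => Nat.find_spec (hex n)⟩
  refine ⟨fun k => semilocalIndex (k.unpair.1, (F k.unpair.2).unpair), ?_, ?_⟩
  · have h1 : Computable fun k : ℕ => (k.unpair.1, (F k.unpair.2).unpair) :=
      (Computable.fst.comp Computable.unpair).pair
        (Computable.unpair.comp (f := Nat.unpair) (hF.comp (Computable.snd.comp Computable.unpair)))
    exact primrec_semilocalIndex.to_comp.comp h1
  · intro e n
    simp only [Nat.unpair_pair]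
    rw [mem_HTP_iff, semilocalIndex, termsOf_encode, ← exists_semilocalTerms_iff (odd_two_mul_add_one n) (hFs n) e]
    simp only [evalTerms_sumSqTerms_eq_zero]

/-! ### The finite-injury thinning of an enumeration -/

section Construction

/-- The left end of the interval of positions restrained with priority `e`, where `a` records the
stages of the current actions. -/
def margin (a : ℕ → ℕ) (e : ℕ) : ℕ := ∑ i ∈ Finset.range (e + 1), a i + 1

/-- The position `i` is restrained with higher priority than `e`. -/
def Restrained (a : ℕ → ℕ) (e i : ℕ) : Prop :=
  ∃ e' < e, margin a e' ≤ i ∧ i < margin a e' * (e' + 2)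

/-- The requirement `s.unpair.1` acts at stage `s`: its polynomial has a solution, coded by
`s.unpair.2.unpair.1`, whose denominators can be inverted without violating restraints. -/
def Acts (q : ℕ → ℕ) (s : ℕ) (a : ℕ → ℕ) : Prop :=
  0 < s ∧ a s.unpair.1 = 0 ∧ ¬ Restrained a s.unpair.1 (s - 1) ∧
    IsWitness s.unpair.1.unpair.1 s.unpair.2.unpair.1 ∧
    ∀ v ∈ witnessBase s.unpair.2.unpair.1, ¬ v ∣ 2 * s.unpair.1.unpair.2 + 1 ∧
      ∃ i < s, ¬ Restrained a s.unpair.1 i ∧ q i = v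

open scoped Classical in
/-- A stage of the construction. -/
noncomputable def stageStep (q : ℕ → ℕ) (s : ℕ) (x : List ℕ × List ℕ) : List ℕ × List ℕ :=
  if Acts q s (fun i => x.1.getD i 0) then
    ((List.range s.unpair.1).map (fun i => x.1.getD i 0) ++ [s],
      x.2 ++ ((List.range s).filter fun i =>
        ¬ Restrained (fun i => x.1.getD i 0) s.unpair.1 i ∧ q i ∉ x.2).map q)
  else x

/-- The stages of the current actions and the list of enumerated numbers, before stage `s`. -/
noncomputable def stageState (q : ℕ → ℕ) (s : ℕ) : List ℕ × List ℕ :=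
  Nat.rec ([], []) (stageStep q) s

/-- The current actions before stage `s`. -/
noncomputable def actionAt (q : ℕ → ℕ) (s e : ℕ) : ℕ := (stageState q s).1.getD e 0

/-- The numbers enumerated before stage `s`. -/
noncomputable def enumerated (q : ℕ → ℕ) (s : ℕ) : List ℕ := (stageState q s).2

/-- The set of numbers enumerated at any stage. -/
def thinned (q : ℕ → ℕ) : Set ℕ := {v | ∃ s, v ∈ enumerated q s}

variable {q : ℕ → ℕ}

theorem actionAt_zero (e : ℕ) : actionAt q 0 e = 0 := by simp [actionAt, stageState]

theorem enumerated_zero : enumerated q 0 = [] := rfl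

theorem stageState_succ (s : ℕ) : stageState q (s + 1) = stageStep q s (stageState q s) := rfl

theorem actionAt_succ_of_not {s : ℕ} (h : ¬ Acts q s (actionAt q s)) :
    actionAt q (s + 1) = actionAt q s := by
  have h' : ¬ Acts q s fun i => (stageState q s).1.getD i 0 := h
  unfold actionAt
  rw [stageState_succ, stageStep, if_neg h']

theorem enumerated_succ_of_not {s : ℕ} (h : ¬ Acts q s (actionAt q s)) :
    enumerated q (s + 1) = enumerated q s := by
  have h' : ¬ Acts q s fun i => (stageState q s).1.getD i 0 := h
  unfold enumerated
  rw [stageState_succ, stageStep, if_neg h']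

theorem actionAt_succ {s : ℕ} (h : Acts q s (actionAt q s)) (e : ℕ) :
    actionAt q (s + 1) e =
      if e < s.unpair.1 then actionAt q s e else if e = s.unpair.1 then s else 0 := by
  have h' : Acts q s fun i => (stageState q s).1.getD i 0 := h
  have : (stageState q (s + 1)).1 =
      (List.range s.unpair.1).map (actionAt q s) ++ [s] := by
    rw [stageState_succ, stageStep, if_pos h']; rfl
  rw [actionAt, this]
  rcases lt_trichotomy e s.unpair.1 with h1 | h1 | h1
  · simp [List.getD_eq_getElem?_getD, List.getElem?_append, h1]
  · simp [List.getD_eq_getElem?_getD, h1]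
  · have h2 : ¬ e < s.unpair.1 := by omega
    have h3 : e ≠ s.unpair.1 := by omega
    have h4 : e - s.unpair.1 ≠ 0 := by omega
    simp [List.getD_eq_getElem?_getD, List.getElem?_append, h2, h3, h4]

open scoped Classical in
theorem enumerated_succ {s : ℕ} (h : Acts q s (actionAt q s)) :
    enumerated q (s + 1) = enumerated q s ++ ((List.range s).filter fun i =>
      ¬ Restrained (actionAt q s) s.unpair.1 i ∧ q i ∉ enumerated q s).map q := by
  have h' : Acts q s fun i => (stageState q s).1.getD i 0 := h
  rw [enumerated, stageState_succ, stageStep, if_pos h']; rfl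

theorem actionAt_succ_of_lt {s e : ℕ} (h : Acts q s (actionAt q s) → e < s.unpair.1) :
    actionAt q (s + 1) e = actionAt q s e := by
  by_cases ha : Acts q s (actionAt q s)
  · rw [actionAt_succ ha, if_pos (h ha)]
  · rw [actionAt_succ_of_not ha]

theorem actionAt_eq_of_le {s t e : ℕ} (hst : s ≤ t)
    (h : ∀ r, s ≤ r → r < t → Acts q r (actionAt q r) → e < r.unpair.1) :
    actionAt q t e = actionAt q s e := by
  induction t, hst using Nat.le_induction with
  | base => rfl
  | succ t hst ih =>
    rw [actionAt_succ_of_lt (h t hst (Nat.lt_succ_self t)),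
      ih fun r h₁ h₂ => h r h₁ (by omega)]

/-- A nonzero entry is the stage of an action. -/
theorem acts_of_actionAt_ne_zero {s e : ℕ} (h : actionAt q s e ≠ 0) :
    actionAt q s e < s ∧ (actionAt q s e).unpair.1 = e ∧
      Acts q (actionAt q s e) (actionAt q (actionAt q s e)) := by
  induction s with
  | zero => exact absurd (actionAt_zero e) h
  | succ s ih =>
    by_cases ha : Acts q s (actionAt q s)
    · rw [actionAt_succ ha] at h ⊢
      split_ifs at h ⊢ with h1 h2
      · obtain ⟨h3, h4⟩ := ih h
        exact ⟨by omega, h4⟩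
      · exact ⟨by omega, h2.symm, ha⟩
      · exact absurd rfl h
    · rw [actionAt_succ_of_not ha] at h ⊢
      obtain ⟨h3, h4⟩ := ih h
      exact ⟨by omega, h4⟩

/-- Every requirement is injured finitely often. -/
theorem exists_forall_acts_ge (q : ℕ → ℕ) (e : ℕ) :
    ∃ s₀, ∀ s ≥ s₀, Acts q s (actionAt q s) → e ≤ s.unpair.1 := by
  induction e with
  | zero => exact ⟨0, fun _ _ _ => Nat.zero_le _⟩
  | succ e ih =>
    obtain ⟨s₀, hs₀⟩ := ih
    by_cases hex : ∃ s ≥ s₀, Acts q s (actionAt q s) ∧ s.unpair.1 = e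
    · obtain ⟨s₁, hs₁, ha, he⟩ := hex
      -- With no stronger actions left, the record s₁ > 0 is never erased, and a nonzero record
      -- forbids acting again.
      have hne : ∀ s ≥ s₁ + 1, actionAt q s e = s₁ := by
        intro s hs
        induction s, hs using Nat.le_induction with
        | base => rw [actionAt_succ ha, if_neg (by omega), if_pos he.symm]
        | succ s hs ih =>
          rw [actionAt_succ_of_lt, ih]
          intro ha'
          refine lt_of_le_of_ne (hs₀ s (by omega) ha') ?_
          rintro he'
          have := ha'.2.1
          rw [← he', ih] at this
          exact ha.1.ne' this
      refine ⟨s₁ + 1, fun s hs ha' => ?_⟩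
      refine lt_of_le_of_ne (hs₀ s (by omega) ha') ?_
      rintro he'
      have h0 := ha'.2.1
      rw [← he', hne s hs] at h0
      exact ha.1.ne' h0
    · refine ⟨s₀, fun s hs ha' => lt_of_le_of_ne (hs₀ s hs ha') fun he => hex ⟨s, hs, ha', he.symm⟩⟩

theorem exists_finalAction (q : ℕ → ℕ) : ∃ h : ℕ → ℕ, ∀ e, ∃ s₀, ∀ s ≥ s₀,
    (Acts q s (actionAt q s) → e ≤ s.unpair.1) ∧ ∀ x < e, actionAt q s x = h x := by
  choose s₀ hs₀ using exists_forall_acts_ge q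
  have key : ∀ x s, s₀ (x + 1) ≤ s → actionAt q s x = actionAt q (s₀ (x + 1)) x := fun x s hs =>
    actionAt_eq_of_le hs fun r hr _ ha => hs₀ (x + 1) r hr ha
  refine ⟨fun x => actionAt q (s₀ (x + 1)) x, fun e =>
    ⟨s₀ e + ∑ x ∈ Finset.range e, s₀ (x + 1), fun s hs => ⟨hs₀ e s (by omega), fun x hx => ?_⟩⟩⟩
  refine key x s ?_
  have := Finset.single_le_sum (f := fun x => s₀ (x + 1)) (fun _ _ => Nat.zero_le _)
    (Finset.mem_range.2 hx)
  omega

/-- The eventual value of `actionAt`. -/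
noncomputable def finalAction (q : ℕ → ℕ) : ℕ → ℕ := (exists_finalAction q).choose

theorem finalAction_spec (q : ℕ → ℕ) (e : ℕ) : ∃ s₀, ∀ s ≥ s₀,
    (Acts q s (actionAt q s) → e ≤ s.unpair.1) ∧ ∀ x < e, actionAt q s x = finalAction q x :=
  (exists_finalAction q).choose_spec e

theorem actionAt_eq_finalAction {s e : ℕ}
    (h : ∀ r ≥ s, Acts q r (actionAt q r) → e < r.unpair.1) :
    actionAt q s e = finalAction q e := by
  obtain ⟨s₀, hs₀⟩ := finalAction_spec q (e + 1)
  rw [← (hs₀ (max s s₀) (le_max_right _ _)).2 e (Nat.lt_succ_self e)]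
  exact (actionAt_eq_of_le (le_max_left _ _) fun r hr _ => h r hr).symm

/-- The last action with priority higher than `e` is recorded. -/
theorem exists_finalAction_ge {s e : ℕ} (ha : Acts q s (actionAt q s)) (he : s.unpair.1 < e) :
    ∃ x < e, s ≤ finalAction q x := by
  obtain ⟨s₀, hs₀⟩ := finalAction_spec q e
  classical
  let p : ℕ → Prop := fun t => Acts q t (actionAt q t) ∧ t.unpair.1 < e
  have hle : ∀ t, p t → t ≤ s₀ := by
    intro t ht
    by_contra hlt
    exact absurd ((hs₀ t (by omega)).1 ht.1) (by have := ht.2; omega)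
  have hs : p s := ⟨ha, he⟩
  -- Take the last action of priority below `e`: no later action can overwrite its record.
  set t := Nat.findGreatest p s₀ with ht
  have htp : p t := Nat.findGreatest_spec (hle s hs) hs
  refine ⟨t.unpair.1, htp.2, (Nat.le_findGreatest (hle s hs) hs).trans ?_⟩
  rw [← actionAt_eq_finalAction (s := t + 1), actionAt_succ htp.1, if_neg (lt_irrefl _), if_pos rfl]
  intro r hr har
  by_contra hlt
  have hpr : p r := ⟨har, by have := htp.2; omega⟩
  have := Nat.le_findGreatest (hle r hpr) hpr
  omega

theorem margin_gt {a : ℕ → ℕ} {x e : ℕ} (h : x ≤ e) : a x < margin a e := by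
  have := Finset.single_le_sum (f := a) (fun _ _ => Nat.zero_le _)
    (Finset.mem_range.2 (show x < e + 1 by omega))
  unfold margin
  omega

theorem margin_congr {a b : ℕ → ℕ} {e : ℕ} (h : ∀ x ≤ e, a x = b x) : margin a e = margin b e := by
  unfold margin
  rw [Finset.sum_congr rfl fun x hx => h x (by simpa [Nat.lt_succ_iff] using hx)]

theorem restrained_congr {a b : ℕ → ℕ} {e i : ℕ} (h : ∀ x < e, a x = b x) :
    Restrained a e i ↔ Restrained b e i := by
  unfold Restrained
  refine exists_congr fun e' => and_congr_right fun he' => ?_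
  rw [margin_congr fun x hx => h x (by omega)]

theorem mem_enumerated_iff {s v : ℕ} : v ∈ enumerated q s ↔ ∃ t < s, Acts q t (actionAt q t) ∧
    ∃ i < t, ¬ Restrained (actionAt q t) t.unpair.1 i ∧ q i = v := by
  induction s with
  | zero => simp [enumerated_zero]
  | succ s ih =>
    by_cases ha : Acts q s (actionAt q s)
    · rw [enumerated_succ ha, List.mem_append, ih]
      simp only [List.mem_map, List.mem_filter, List.mem_range, decide_eq_true_eq]
      constructor
      · rintro (⟨t, ht, h⟩ | ⟨i, ⟨hi, hr, -⟩, hv⟩)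
        · exact ⟨t, by omega, h⟩
        · exact ⟨s, by omega, ha, i, hi, hr, hv⟩
      · rintro ⟨t, ht, hat, i, hi, hr, hv⟩
        rcases Nat.lt_succ_iff_lt_or_eq.1 ht with ht | rfl
        · exact Or.inl ⟨t, ht, hat, i, hi, hr, hv⟩
        · by_cases hm : q i ∈ enumerated q t
          · exact Or.inl (ih.1 (hv ▸ hm))
          · exact Or.inr ⟨i, ⟨hi, hr, hm⟩, hv⟩
    · rw [enumerated_succ_of_not ha, ih]
      constructor
      · rintro ⟨t, ht, h⟩
        exact ⟨t, by omega, h⟩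
      · rintro ⟨t, ht, h⟩
        refine ⟨t, lt_of_le_of_ne (by omega) ?_, h⟩
        rintro rfl
        exact ha h.1

theorem mem_thinned_iff {v : ℕ} : v ∈ thinned q ↔ ∃ t, Acts q t (actionAt q t) ∧
    ∃ i < t, ¬ Restrained (actionAt q t) t.unpair.1 i ∧ q i = v := by
  simp only [thinned, Set.mem_ofPred_eq, mem_enumerated_iff]
  constructor
  · rintro ⟨s, t, -, h⟩
    exact ⟨t, h⟩
  · rintro ⟨t, h⟩
    exact ⟨t + 1, t, by omega, h⟩

theorem thinned_subset : thinned q ⊆ Set.range q := by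
  intro v hv
  obtain ⟨-, -, i, -, -, rfl⟩ := mem_thinned_iff.1 hv
  exact ⟨i, rfl⟩

/-- The eventual restraints are obeyed. -/
theorem not_mem_thinned_of_restrained (hq : Function.Injective q) {e i : ℕ}
    (h : Restrained (finalAction q) e i) : q i ∉ thinned q := by
  rw [mem_thinned_iff]
  rintro ⟨s, ha, j, hj, hr, hji⟩
  obtain rfl := hq hji
  obtain ⟨e', -, h₁, h₂⟩ := h
  -- An action of priority at most e' from stage s on would leave a final record at least s, pushing
  -- the final margin beyond j < s. Hence the final restraint of e' was already in force when j was
  -- enumerated.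
  have hno : ∀ r ≥ s, Acts q r (actionAt q r) → e' < r.unpair.1 := by
    intro r hr har
    by_contra hlt
    obtain ⟨x, hx, hx'⟩ := exists_finalAction_ge (e := e' + 1) har (by omega)
    have := margin_gt (a := finalAction q) (Nat.le_of_lt_succ hx)
    omega
  refine hr ⟨e', hno s le_rfl ha, ?_⟩
  rw [margin_congr (b := finalAction q)]
  · exact ⟨h₁, h₂⟩
  · exact fun x hx => actionAt_eq_finalAction fun r hr har => hx.trans_lt (hno r hr har)

/-- Once the actions of higher priority have settled, a nonzero entry is final. -/
theorem finalAction_eq_of_agree {s e : ℕ} (h : ∀ x < e, actionAt q s x = finalAction q x)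
    (he : actionAt q s e ≠ 0) : finalAction q e = actionAt q s e := by
  have hno : ∀ r ≥ s, Acts q r (actionAt q r) → e ≤ r.unpair.1 := by
    intro r hr har
    by_contra hlt
    -- A stronger action at r ≥ s would leave a final record ≥ r, but the records of higher priority
    -- at stage s are final by assumption and less than s.
    obtain ⟨x, hx, hx'⟩ := exists_finalAction_ge (e := e) har (by omega)
    have hs := (acts_of_actionAt_ne_zero he).1
    rw [← h x hx] at hx'
    have := (acts_of_actionAt_ne_zero (q := q) (s := s) (e := x) (by omega)).1
    omega
  have hconst : ∀ t ≥ s, actionAt q t e = actionAt q s e := by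
    intro t ht
    induction t, ht using Nat.le_induction with
    | base => rfl
    | succ t ht ih =>
      rw [actionAt_succ_of_lt, ih]
      intro ha
      refine lt_of_le_of_ne (hno t ht ha) ?_
      intro he'
      have := ha.2.1
      rw [← he', ih] at this
      exact he this
  obtain ⟨s₀, hs₀⟩ := finalAction_spec q (e + 1)
  rw [← (hs₀ (max s s₀) (le_max_right _ _)).2 e (Nat.lt_succ_self e), hconst _ (le_max_left _ _)]

/-- The `e`-th requirement is satisfied by an action. -/
theorem acts_of_finalAction_ne_zero {e : ℕ} (h : finalAction q e ≠ 0) :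
    (finalAction q e).unpair.1 = e ∧ Acts q (finalAction q e) (actionAt q (finalAction q e)) := by
  obtain ⟨s₀, hs₀⟩ := finalAction_spec q (e + 1)
  rw [← (hs₀ s₀ le_rfl).2 e (Nat.lt_succ_self e)] at h ⊢
  exact (acts_of_actionAt_ne_zero h).2

/-- The final action enumerates every unrestrained position below its stage, in particular those of
the denominators of its witness. -/
theorem exists_witness_of_finalAction_ne_zero {e : ℕ} (h : finalAction q e ≠ 0) :
    ∃ w, IsWitness e.unpair.1 w ∧
      ∀ v ∈ witnessBase w, v ∈ thinned q ∧ ¬ v ∣ 2 * e.unpair.2 + 1 := by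
  obtain ⟨he, ha⟩ := acts_of_finalAction_ne_zero h
  set s := finalAction q e
  obtain ⟨-, -, -, hw, hb⟩ := id ha
  rw [he] at hw hb
  refine ⟨_, hw, fun v hv => ⟨?_, (hb v hv).1⟩⟩
  obtain ⟨-, i, hi, hr, hv⟩ := hb v hv
  exact mem_thinned_iff.2 ⟨s, ha, i, hi, he.symm ▸ hr, hv⟩

theorem exists_forall_not_restrained (a : ℕ → ℕ) (e : ℕ) : ∃ B, ∀ i ≥ B, ¬ Restrained a e i := by
  refine ⟨∑ e' ∈ Finset.range e, margin a e' * (e' + 2), fun i hi => ?_⟩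
  rintro ⟨e', he', -, h⟩
  have := Finset.single_le_sum (f := fun e' => margin a e' * (e' + 2)) (fun _ _ => Nat.zero_le _)
    (Finset.mem_range.2 he')
  omega

/-- If `e` settled without an action, it would be entitled to act at a late stage reserved for it
and w, after the stronger requirements have settled. -/
theorem finalAction_ne_zero {e w : ℕ} (hw : IsWitness e.unpair.1 w)
    (hb : ∀ v ∈ witnessBase w, ¬ v ∣ 2 * e.unpair.2 + 1 ∧
      ∃ i, ¬ Restrained (finalAction q) e i ∧ q i = v) : finalAction q e ≠ 0 := by
  intro h0
  obtain ⟨s₀, hs₀⟩ := finalAction_spec q (e + 1)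
  obtain ⟨B, hB⟩ := exists_forall_not_restrained (finalAction q) e
  obtain ⟨C, hC⟩ : ∃ C, ∀ v ∈ witnessBase w, ∃ i < C, ¬ Restrained (finalAction q) e i ∧ q i = v := by
    choose! i hi using fun v hv => (hb v hv).2
    refine ⟨((witnessBase w).map i).sum + 1, fun v hv => ⟨i v, ?_, hi v hv⟩⟩
    exact Nat.lt_succ_of_le (List.le_sum_of_mem (List.mem_map_of_mem hv))
  -- The third component of a stage is mere padding, so each pair (e, w) recurs at arbitrarily late
  -- stages.
  set s := Nat.pair e (Nat.pair w (s₀ + B + C + 1)) with hs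
  have hle : s₀ + B + C + 1 ≤ s := (Nat.right_le_pair _ _).trans (Nat.right_le_pair _ _)
  have he : s.unpair.1 = e := by simp [hs]
  have hw' : s.unpair.2.unpair.1 = w := by simp [hs]
  obtain ⟨h₁, h₂⟩ := hs₀ s (by omega)
  have hres : ∀ i, Restrained (actionAt q s) e i ↔ Restrained (finalAction q) e i := fun i =>
    restrained_congr fun x hx => h₂ x (by omega)
  have : Acts q s (actionAt q s) := by
    rw [Acts, he, hw', h₂ e (by omega), hres]
    refine ⟨by omega, h0, hB _ (by omega), hw, fun v hv => ⟨(hb v hv).1, ?_⟩⟩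
    obtain ⟨i, hi, hi'⟩ := hC v hv
    exact ⟨i, by omega, by rwa [hres]⟩
  have := h₁ this
  omega

/-- The eventual action of a requirement tells the answer for the thinned set. -/
theorem finalAction_ne_zero_iff (hq : Function.Injective q) (e : ℕ) :
    finalAction q e ≠ 0 ↔ ∃ w, IsWitness e.unpair.1 w ∧
      ∀ v ∈ witnessBase w, v ∈ thinned q ∧ ¬ v ∣ 2 * e.unpair.2 + 1 := by
  refine ⟨exists_witness_of_finalAction_ne_zero, ?_⟩
  rintro ⟨w, hw, h⟩
  refine finalAction_ne_zero hw fun v hv => ⟨(h v hv).2, ?_⟩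
  obtain ⟨i, rfl⟩ := thinned_subset (h v hv).1
  exact ⟨i, fun hr => not_mem_thinned_of_restrained hq hr (h _ hv).1, rfl⟩

/-- The eventual action of a requirement tells the answer for the original set with the restrained
elements removed. -/
theorem finalAction_ne_zero_iff_not_restrained (hq : Function.Injective q) (e : ℕ) :
    finalAction q e ≠ 0 ↔ ∃ w, IsWitness e.unpair.1 w ∧
      ∀ v ∈ witnessBase w, ¬ v ∣ 2 * e.unpair.2 + 1 ∧
        ∃ i, ¬ Restrained (finalAction q) e i ∧ q i = v := by
  refine ⟨fun h => ?_, fun ⟨w, hw, h⟩ => finalAction_ne_zero hw h⟩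
  obtain ⟨w, hw, h⟩ := exists_witness_of_finalAction_ne_zero h
  refine ⟨w, hw, fun v hv => ⟨(h v hv).2, ?_⟩⟩
  obtain ⟨i, rfl⟩ := thinned_subset (h v hv).1
  exact ⟨i, fun hr => not_mem_thinned_of_restrained hq hr (h _ hv).1, rfl⟩

/-- The zero polynomial has a witness without denominators, so all of its infinitely many
requirements finally act; the stage of an action is at least the index of its requirement. -/
theorem exists_acts_ge (q : ℕ → ℕ) (n : ℕ) : ∃ s ≥ n, Acts q s (actionAt q s) := by
  have h0 : IsWitness (Encodable.encode ([] : List (ℤ × List ℕ)))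
      (Encodable.encode (([], []) : List ℤ × List ℕ)) := by
    rw [IsWitness, termsOf_encode]
    exact evalTerms_nil _
  set e := Nat.pair (Encodable.encode ([] : List (ℤ × List ℕ))) n with he
  have hne : finalAction q e ≠ 0 := by
    refine finalAction_ne_zero (w := Encodable.encode (([], []) : List ℤ × List ℕ)) ?_ ?_
    · rw [he, Nat.unpair_pair]; exact h0
    · rw [witnessBase, Denumerable.ofNat_encode]; simp
  obtain ⟨h₁, h₂⟩ := acts_of_finalAction_ne_zero hne
  refine ⟨_, ?_, h₂⟩
  calc n ≤ e := Nat.right_le_pair _ _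
    _ = (finalAction q e).unpair.1 := h₁.symm
    _ ≤ _ := Nat.unpair_left_le _

theorem enumerated_prefix_succ (s : ℕ) : enumerated q s <+: enumerated q (s + 1) := by
  by_cases ha : Acts q s (actionAt q s)
  · rw [enumerated_succ ha]; exact List.prefix_append _ _
  · rw [enumerated_succ_of_not ha]

theorem enumerated_prefix {s t : ℕ} (h : s ≤ t) : enumerated q s <+: enumerated q t := by
  induction t, h using Nat.le_induction with
  | base => exact List.prefix_rfl
  | succ t _ ih => exact ih.trans (enumerated_prefix_succ t)

/-- The clause of `Acts` about position s - 1 is there for this: that position is unrestrained, and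
earlier stages could reach only smaller ones. -/
theorem length_enumerated_lt (hq : Function.Injective q) {s : ℕ} (ha : Acts q s (actionAt q s)) :
    (enumerated q s).length < (enumerated q (s + 1)).length := by
  rw [enumerated_succ ha, List.length_append, Nat.lt_add_right_iff_pos, List.length_pos_iff_exists_mem]
  refine ⟨q (s - 1), List.mem_map_of_mem ?_⟩
  have hs := ha.1
  simp only [List.mem_filter, List.mem_range, decide_eq_true_eq]
  refine ⟨by omega, ha.2.2.1, fun h => ?_⟩
  obtain ⟨t, ht, -, i, hi, -, hiq⟩ := mem_enumerated_iff.1 h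
  have := hq hiq
  omega

theorem exists_length_enumerated_gt (hq : Function.Injective q) (n : ℕ) :
    ∃ s, n < (enumerated q s).length := by
  suffices h : ∃ s, n ≤ (enumerated q s).length by
    obtain ⟨s, hs⟩ := h
    obtain ⟨t, ht, ha⟩ := exists_acts_ge q s
    exact ⟨t + 1, (hs.trans (enumerated_prefix ht).length_le).trans_lt (length_enumerated_lt hq ha)⟩
  induction n with
  | zero => exact ⟨0, Nat.zero_le _⟩
  | succ n ih =>
    obtain ⟨s, hs⟩ := ih
    obtain ⟨t, ht, ha⟩ := exists_acts_ge q s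
    exact ⟨t + 1, (hs.trans (enumerated_prefix ht).length_le).trans_lt (length_enumerated_lt hq ha)⟩

theorem nodup_enumerated (hq : Function.Injective q) (s : ℕ) : (enumerated q s).Nodup := by
  induction s with
  | zero => simp [enumerated_zero]
  | succ s ih =>
    by_cases ha : Acts q s (actionAt q s)
    · rw [enumerated_succ ha, List.nodup_append']
      refine ⟨ih, (List.Nodup.filter _ List.nodup_range).map hq, ?_⟩
      rw [List.disjoint_right]
      intro v hv
      obtain ⟨i, hi, rfl⟩ := List.mem_map.1 hv
      simp only [List.mem_filter, List.mem_range, decide_eq_true_eq] at hi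
      exact hi.2.2
    · rwa [enumerated_succ_of_not ha]

/-- Margins are at least 1. This keeps the prime 2 in first place at every level. -/
theorem not_restrained_zero (a : ℕ → ℕ) (e : ℕ) : ¬ Restrained a e 0 := by
  rintro ⟨e', -, h, -⟩
  simp [margin] at h

theorem enumerated_getD_zero {s : ℕ} (h : 0 < (enumerated q s).length) :
    (enumerated q s).getD 0 0 = q 0 := by
  induction s with
  | zero => simp [enumerated_zero] at h
  | succ s ih =>
    by_cases h0 : 0 < (enumerated q s).length
    · rw [← ih h0]
      obtain ⟨l, hl⟩ := enumerated_prefix_succ (q := q) s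
      rw [← hl, List.getD_append _ _ _ _ h0]
    · by_cases ha : Acts q s (actionAt q s)
      · have hnil : enumerated q s = [] := List.eq_nil_of_length_eq_zero (by omega)
        rw [enumerated_succ ha, hnil]
        obtain ⟨s', rfl⟩ : ∃ s', s = s' + 1 := ⟨s - 1, by have := ha.1; omega⟩
        rw [List.range_succ_eq_map, List.filter_cons_of_pos]
        · simp
        · simp [not_restrained_zero]
      · rw [enumerated_succ_of_not ha] at h
        exact absurd h h0

/-- Stage t reads only positions below t, so the construction can be run on finite initial segments.
-/
theorem stageState_congr {q q' : ℕ → ℕ} {s : ℕ} (h : ∀ i < s, q i = q' i) :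
    stageState q s = stageState q' s := by
  induction s with
  | zero => rfl
  | succ s ih =>
    rw [stageState_succ, stageState_succ, ih fun i hi => h i (by omega)]
    have hact : ∀ a, Acts q s a ↔ Acts q' s a := by
      intro a
      unfold Acts
      have : ∀ v, (∃ i < s, ¬ Restrained a s.unpair.1 i ∧ q i = v) ↔
          ∃ i < s, ¬ Restrained a s.unpair.1 i ∧ q' i = v := fun v =>
        exists_congr fun i => and_congr_right fun hi => by rw [h i (by omega)]
      simp only [this]
    by_cases ha : Acts q s fun i => (stageState q' s).1.getD i 0
    · rw [stageStep, stageStep, if_pos ha, if_pos ((hact _).1 ha)]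
      congr 2
      have hf : ∀ i ∈ List.range s, q i = q' i := fun i hi =>
        h i (by have := List.mem_range.1 hi; omega)
      rw [List.filter_congr fun i hi => by rw [hf i hi]]
      exact List.map_congr_left fun i hi => hf i (List.mem_of_mem_filter hi)
    · rw [stageStep, stageStep, if_neg ha, if_neg fun h' => ha ((hact _).2 h')]

end Construction

/-! ### Computability of the thinning on initial segments -/

section ThinListPrimrec

open Primrec

theorem primrec_margin : Primrec₂ fun (l : List ℕ) e => margin (fun i => l.getD i 0) e :=
  Primrec.succ.comp ((list_sum nat_add).comp (list_map (list_range.comp (Primrec.succ.comp snd))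
    ((list_getD 0).comp (fst.comp fst) snd).to₂))

theorem primrecPred_restrained :
    PrimrecPred fun p : List ℕ × ℕ × ℕ => Restrained (fun i => p.1.getD i 0) p.2.1 p.2.2 := by
  have hm : Primrec fun a : (List ℕ × ℕ × ℕ) × ℕ => margin (fun i => a.1.1.getD i 0) a.2 :=
    primrec_margin.comp (fst.comp fst) snd
  refine PrimrecPred.exists_lt' (p := fun (p : List ℕ × ℕ × ℕ) e' =>
    margin (fun i => p.1.getD i 0) e' ≤ p.2.2 ∧
      p.2.2 < margin (fun i => p.1.getD i 0) e' * (e' + 2)) ?_ (fst.comp snd)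
  exact (nat_le.comp hm (snd.comp (snd.comp fst))).and
    (nat_lt.comp (snd.comp (snd.comp fst)) (nat_mul.comp hm (nat_add.comp snd (const 2))))

theorem primrecPred_acts : PrimrecPred fun p : List ℕ × ℕ × List ℕ =>
    Acts (fun i => p.1.getD i 0) p.2.1 (fun i => p.2.2.getD i 0) := by
  have hs : Primrec fun p : List ℕ × ℕ × List ℕ => p.2.1 := fst.comp snd
  have hA : Primrec fun p : List ℕ × ℕ × List ℕ => p.2.2 := snd.comp snd
  have he : Primrec fun p : List ℕ × ℕ × List ℕ => p.2.1.unpair.1 := fst.comp (unpair.comp hs)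
  have hw : Primrec fun p : List ℕ × ℕ × List ℕ => p.2.1.unpair.2.unpair.1 :=
    fst.comp (unpair.comp (snd.comp (unpair.comp hs)))
  refine (nat_lt.comp (const 0) hs).and <| (Primrec.eq.comp ((list_getD 0).comp hA he) (const 0)).and <|
    (primrecPred_restrained.comp (hA.pair (he.pair (nat_sub.comp hs (const 1))))).not.and <|
    (primrecRel_isWitness.comp (fst.comp (unpair.comp he)) hw).and <|
    PrimrecPred.list_all (p := fun (p : List ℕ × ℕ × List ℕ) v =>
      ¬ v ∣ 2 * p.2.1.unpair.1.unpair.2 + 1 ∧ ∃ i < p.2.1,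
        ¬ Restrained (fun i => p.2.2.getD i 0) p.2.1.unpair.1 i ∧ p.1.getD i 0 = v)
      (PrimrecPred.and ?_ ?_) (primrec_witnessBase.comp hw)
  · exact (PrimrecPred.nat_dvd.comp snd
      (nat_double_succ.comp (snd.comp (unpair.comp (he.comp fst))))).not
  · refine PrimrecPred.exists_lt' (p := fun (a : (List ℕ × ℕ × List ℕ) × ℕ) i =>
      ¬ Restrained (fun i => a.1.2.2.getD i 0) a.1.2.1.unpair.1 i ∧ a.1.1.getD i 0 = a.2) ?_
      (hs.comp fst)
    exact (primrecPred_restrained.comp ((hA.comp (fst.comp fst)).pair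
      ((he.comp (fst.comp fst)).pair snd))).not.and
      (Primrec.eq.comp ((list_getD 0).comp (fst.comp (fst.comp fst)) snd) (snd.comp fst))

theorem primrec_stageState :
    Primrec₂ fun (l : List ℕ) s => stageState (fun i => l.getD i 0) s := by
  classical
  refine Primrec.nat_rec (f := fun _ : List ℕ => (([], []) : List ℕ × List ℕ))
    (g := fun l p => stageStep (fun i => l.getD i 0) p.1 p.2) (const _) ?_
  have hl : Primrec fun a : List ℕ × ℕ × List ℕ × List ℕ => a.1 := fst
  have hs : Primrec fun a : List ℕ × ℕ × List ℕ × List ℕ => a.2.1 := fst.comp snd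
  have hA : Primrec fun a : List ℕ × ℕ × List ℕ × List ℕ => a.2.2.1 := fst.comp (snd.comp snd)
  have ho : Primrec fun a : List ℕ × ℕ × List ℕ × List ℕ => a.2.2.2 := snd.comp (snd.comp snd)
  have he : Primrec fun a : List ℕ × ℕ × List ℕ × List ℕ => a.2.1.unpair.1 :=
    fst.comp (unpair.comp hs)
  refine Primrec.ite (primrecPred_acts.comp (hl.pair (hs.pair hA))) (Primrec.pair ?_ ?_)
    (snd.comp snd)
  · exact list_append.comp (list_map (list_range.comp he)
      ((list_getD 0).comp (hA.comp fst) snd).to₂) (list_cons.comp hs (const []))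
  · refine list_append.comp ho (list_map (PrimrecPred.list_filter
      (p := fun (a : List ℕ × ℕ × List ℕ × List ℕ) i =>
        ¬ Restrained (fun i => a.2.2.1.getD i 0) a.2.1.unpair.1 i ∧ a.1.getD i 0 ∉ a.2.2.2)
      (PrimrecPred.and ?_ ?_) (list_range.comp hs)) ((list_getD 0).comp (hl.comp fst) snd).to₂)
    · exact (primrecPred_restrained.comp ((hA.comp fst).pair ((he.comp fst).pair snd))).not
    · refine ((PrimrecPred.list_exists (p := fun (b : (List ℕ × ℕ × List ℕ × List ℕ) × ℕ) v =>
        v = b.1.1.getD b.2 0) (f := fun b => b.1.2.2.2) ?_ (ho.comp fst)).not).of_eq fun b => by simp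
      exact Primrec.eq.comp snd ((list_getD 0).comp (hl.comp (fst.comp fst)) (snd.comp fst))

end ThinListPrimrec

/-- The construction, applied to a finite initial segment of an enumeration. -/
noncomputable def thinList (l : List ℕ) : List ℕ := enumerated (fun i => l.getD i 0) l.length

theorem primrec_thinList : Primrec thinList :=
  Primrec.snd.comp (primrec_stageState.comp Primrec.id Primrec.list_length)

section PrefixLimit

/-- The sequence with the given initial segments. -/
noncomputable def prefixLimit (L : ℕ → List ℕ) (n : ℕ) : ℕ :=
  (L (sInf {s | n < (L s).length})).getD n 0

variable {L : ℕ → List ℕ}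

theorem prefixLimit_eq (hmono : ∀ s t, s ≤ t → L s <+: L t) {s n : ℕ} (h : n < (L s).length) :
    prefixLimit L n = (L s).getD n 0 := by
  have hmem : n < (L (sInf {s | n < (L s).length})).length := Nat.sInf_mem (s := {s | n < (L s).length}) ⟨s, h⟩
  obtain ⟨l, hl⟩ := hmono _ s (Nat.sInf_le (show s ∈ {s | n < (L s).length} from h))
  rw [prefixLimit, ← hl, List.getD_append _ _ _ _ hmem]

theorem range_prefixLimit (hmono : ∀ s t, s ≤ t → L s <+: L t)
    (hunb : ∀ n, ∃ s, n < (L s).length) : Set.range (prefixLimit L) = {v | ∃ s, v ∈ L s} := by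
  ext v
  constructor
  · rintro ⟨n, rfl⟩
    obtain ⟨s, hs⟩ := hunb n
    refine ⟨s, ?_⟩
    rw [prefixLimit_eq hmono hs, List.getD_eq_getElem _ _ hs]
    exact List.getElem_mem hs
  · rintro ⟨s, hs⟩
    obtain ⟨n, hn, rfl⟩ := List.getElem_of_mem hs
    exact ⟨n, by rw [prefixLimit_eq hmono hn, List.getD_eq_getElem _ _ hn]⟩

theorem prefixLimit_injective (hmono : ∀ s t, s ≤ t → L s <+: L t)
    (hunb : ∀ n, ∃ s, n < (L s).length) (hnd : ∀ s, (L s).Nodup) :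
    Function.Injective (prefixLimit L) := by
  intro m n hmn
  obtain ⟨s, hs⟩ := hunb (max m n)
  have hm : m < (L s).length := (le_max_left _ _).trans_lt hs
  have hn : n < (L s).length := (le_max_right _ _).trans_lt hs
  rw [prefixLimit_eq hmono hm, prefixLimit_eq hmono hn, List.getD_eq_getElem _ _ hm,
    List.getD_eq_getElem _ _ hn] at hmn
  exact (hnd s).getElem_inj_iff.1 hmn

theorem thinList_eq (hmono : ∀ s t, s ≤ t → L s <+: L t) (s : ℕ) :
    thinList (L s) = enumerated (prefixLimit L) (L s).length := by
  unfold thinList enumerated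
  rw [stageState_congr fun i hi => (prefixLimit_eq hmono hi).symm]

end PrefixLimit

/-! ### The levels, uniformly in the number of iterations -/

/-- Finite initial segments of the enumeration at level `i`. -/
noncomputable def levelList (i s : ℕ) : List ℕ := thinList^[i] ((List.range s).filter Nat.Prime)

/-- The enumeration at level `i`. -/
noncomputable def levelEnum (i : ℕ) : ℕ → ℕ := prefixLimit (levelList i)

theorem levelList_succ (i s : ℕ) : levelList (i + 1) s = thinList (levelList i s) :=
  Function.iterate_succ_apply' _ _ _

theorem primrec_levelList : Primrec₂ levelList :=
  Primrec.nat_iterate Primrec.fst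
    ((PrimrecPred.list_filter (p := fun (_ : ℕ) p => Nat.Prime p) (f := List.range)
      (PrimrecPred.nat_prime.comp Primrec.snd) Primrec.list_range).comp Primrec.snd)
    (primrec_thinList.comp Primrec.snd).to₂

theorem levelList_spec (i : ℕ) : (∀ s t, s ≤ t → levelList i s <+: levelList i t) ∧
    (∀ n, ∃ s, n < (levelList i s).length) ∧ ∀ s, (levelList i s).Nodup := by
  induction i with
  | zero =>
    have hmono : ∀ s t, s ≤ t → levelList 0 s <+: levelList 0 t := by
      intro s t hst
      obtain ⟨k, rfl⟩ := Nat.exists_eq_add_of_le hst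
      rw [levelList, levelList, List.range_add, Function.iterate_zero, id, id, List.filter_append]
      exact List.prefix_append _ _
    refine ⟨hmono, fun n => ?_, fun s => List.Nodup.filter _ List.nodup_range⟩
    refine ⟨Nat.nth Nat.Prime (n + 1), ?_⟩
    have : (levelList 0 (Nat.nth Nat.Prime (n + 1))).length =
        Nat.count Nat.Prime (Nat.nth Nat.Prime (n + 1)) := by
      rw [Nat.count, List.countP_eq_length_filter]; rfl
    rw [this, Nat.count_nth_of_infinite Nat.infinite_setOfPred_prime]
    omega
  | succ i ih =>
    obtain ⟨hmono, hunb, hnd⟩ := ih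
    have hinj := prefixLimit_injective hmono hunb hnd
    refine ⟨fun s t hst => ?_, fun n => ?_, fun s => ?_⟩
    · rw [levelList_succ, levelList_succ, thinList_eq hmono, thinList_eq hmono]
      exact enumerated_prefix (hmono s t hst).length_le
    · obtain ⟨k, hk⟩ := exists_length_enumerated_gt hinj n
      obtain ⟨s, hs⟩ := hunb k
      refine ⟨s, ?_⟩
      rw [levelList_succ, thinList_eq hmono]
      exact hk.trans_le (enumerated_prefix hs.le).length_le
    · rw [levelList_succ, thinList_eq hmono]
      exact nodup_enumerated hinj _

theorem levelEnum_injective (i : ℕ) : Function.Injective (levelEnum i) :=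
  prefixLimit_injective (levelList_spec i).1 (levelList_spec i).2.1 (levelList_spec i).2.2

theorem range_levelEnum_succ (i : ℕ) :
    Set.range (levelEnum (i + 1)) = thinned (levelEnum i) := by
  obtain ⟨hmono, hunb, -⟩ := levelList_spec i
  rw [levelEnum, range_prefixLimit (levelList_spec _).1 (levelList_spec _).2.1]
  ext v
  simp only [levelList_succ, thinList_eq hmono]
  constructor
  · rintro ⟨s, hs⟩
    exact ⟨_, hs⟩
  · rintro ⟨k, hk⟩
    obtain ⟨s, hs⟩ := hunb k
    exact ⟨s, (enumerated_prefix hs.le).subset hk⟩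

theorem mem_range_levelEnum_zero {v : ℕ} : v ∈ Set.range (levelEnum 0) ↔ v.Prime := by
  rw [levelEnum, range_prefixLimit (levelList_spec _).1 (levelList_spec _).2.1]
  simp only [levelList, Function.iterate_zero, id, Set.mem_ofPred_eq, List.mem_filter,
    List.mem_range, decide_eq_true_eq, exists_and_right, and_iff_right_iff_imp]
  exact fun _ => ⟨v + 1, by omega⟩

theorem levelEnum_zero_strictMono : StrictMono (levelEnum 0) := by
  obtain ⟨hmono, hunb, -⟩ := levelList_spec 0
  intro m n hmn
  obtain ⟨s, hs⟩ := hunb n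
  have hm : m < (levelList 0 s).length := hmn.trans hs
  rw [levelEnum, prefixLimit_eq hmono hm, prefixLimit_eq hmono hs, List.getD_eq_getElem _ _ hm,
    List.getD_eq_getElem _ _ hs]
  have hp : (levelList 0 s).Pairwise (· < ·) :=
    List.Pairwise.filter _ (List.pairwise_lt_range)
  exact List.pairwise_iff_getElem.1 hp m n hm hs hmn

theorem range_levelEnum_subset (i : ℕ) : ∀ v ∈ Set.range (levelEnum i), v.Prime := by
  induction i with
  | zero => exact fun v hv => mem_range_levelEnum_zero.1 hv
  | succ i ih =>
    rw [range_levelEnum_succ]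
    exact fun v hv => ih v (thinned_subset hv)

theorem levelEnum_apply_zero (i : ℕ) : levelEnum i 0 = 2 := by
  induction i with
  | zero =>
    have hmono := (levelList_spec 0).1
    have h3 : levelList 0 3 = [2] := by
      simp [levelList]; decide
    rw [levelEnum, prefixLimit_eq hmono (s := 3) (by rw [h3]; simp), h3]
    rfl
  | succ i ih =>
    obtain ⟨hmono, hunb, -⟩ := levelList_spec i
    obtain ⟨s, hs⟩ := (levelList_spec (i + 1)).2.1 0
    rw [levelEnum, prefixLimit_eq (levelList_spec (i + 1)).1 hs, ← ih]
    rw [levelList_succ, thinList_eq hmono] at hs ⊢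
    exact enumerated_getD_zero hs

theorem computable_levelEnum : Computable₂ levelEnum := by
  have hex : ∀ p : ℕ × ℕ, ∃ s, p.2 < (levelList p.1 s).length := fun p =>
    (levelList_spec p.1).2.1 p.2
  have hL : Primrec fun a : (ℕ × ℕ) × ℕ => levelList a.1.1 a.2 :=
    primrec_levelList.comp (Primrec.fst.comp Primrec.fst) Primrec.snd
  obtain ⟨F, hF, hFs⟩ : ∃ F : ℕ × ℕ → ℕ, Computable F ∧ ∀ p, p.2 < (levelList p.1 (F p)).length :=
    ⟨_, Computable.find (P := fun (p : ℕ × ℕ) s => p.2 < (levelList p.1 s).length)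
      (Primrec.nat_lt.comp (Primrec.snd.comp Primrec.fst)
        (Primrec.list_length.comp hL)).computablePred hex, fun p => Nat.find_spec (hex p)⟩
  have h2 : Primrec fun a : (ℕ × ℕ) × ℕ => (levelList a.1.1 a.2).getD a.1.2 0 :=
    (Primrec.list_getD 0).comp hL (Primrec.snd.comp Primrec.fst)
  refine (h2.to_comp.comp (Computable.id.pair hF)).of_eq fun p => ?_
  exact (prefixLimit_eq (levelList_spec p.1).1 (hFs p)).symm

theorem computable_stageState_levelEnum (i : ℕ) : Computable (stageState (levelEnum i)) := by
  have hex : ∀ n, ∃ s, n < (levelList i s).length := (levelList_spec i).2.1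
  have hL : Primrec (levelList i) := primrec_levelList.comp (Primrec.const i) Primrec.id
  obtain ⟨F, hF, hFs⟩ : ∃ F : ℕ → ℕ, Computable F ∧ ∀ n, n < (levelList i (F n)).length :=
    ⟨_, Computable.find (P := fun n s => n < (levelList i s).length)
      (Primrec.nat_lt.comp Primrec.fst
        (Primrec.list_length.comp (hL.comp Primrec.snd))).computablePred hex,
      fun n => Nat.find_spec (hex n)⟩
  have h2 : Primrec fun a : ℕ × ℕ => stageState (fun j => (levelList i a.2).getD j 0) a.1 :=
    primrec_stageState.comp (hL.comp Primrec.snd) Primrec.fst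
  refine (h2.to_comp.comp (Computable.id.pair hF)).of_eq fun n => ?_
  exact stageState_congr fun j hj =>
    (prefixLimit_eq (levelList_spec i).1 (hj.trans (hFs n))).symm

/-! ### Recursion relative to an oracle -/

section Oracle

theorem turingReducible_of_computable {A B : Set ℕ} {f : ℕ → ℕ} (hf : Computable f)
    (h : ∀ e, e ∈ A ↔ f e ∈ B) : TuringReducible (charFun A) (charFun B) := by
  rw [TuringReducible, RecursiveIn.iff_nat]
  have hf' : Nat.RecursiveIn {charFun B} (fun n => Part.some (f n)) :=
    (Partrec.nat_iff.1 hf.partrec).recursiveIn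
  have hB : Nat.RecursiveIn {charFun B} (charFun B) := .oracle _ (Set.mem_singleton _)
  refine (Nat.RecursiveIn.comp hB hf').of_eq fun n => (Part.bind_some _ _).trans ?_
  unfold charFun
  congr 1
  classical
  simp only [Set.indicator_apply, h]

/-- A problem is Turing reducible to another one if its instances are decided by a recursion which
uses one oracle call in each step. -/
theorem turingReducible_of_recursion {A B : Set ℕ} {H : ℕ → ℕ} (hH : Computable H)
    {ψ : ℕ →. ℕ} (hψ : Partrec ψ) (st : ℕ → ℕ)
    (hst : ∀ e, st (e + 1) ∈ ψ (Nat.pair (Nat.pair e (st e))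
      (B.indicator (fun _ => 1) (H (Nat.pair e (st e))))))
    (hA : ∀ e, e ∈ A ↔ H (Nat.pair e (st e)) ∈ B) :
    TuringReducible (charFun A) (charFun B) := by
  rw [TuringReducible, RecursiveIn.iff_nat]
  have part : ∀ {f : ℕ →. ℕ}, Partrec f → Nat.RecursiveIn {charFun B} f := fun hf =>
    (Partrec.nat_iff.1 hf).recursiveIn
  have hB : Nat.RecursiveIn {charFun B} (charFun B) := .oracle _ (Set.mem_singleton _)
  have hask : Nat.RecursiveIn {charFun B}
      (fun n => Part.some (B.indicator (fun _ => 1) (H n))) :=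
    (Nat.RecursiveIn.comp hB (part hH.partrec)).of_eq fun n => Part.bind_some _ _
  have hstep : Nat.RecursiveIn {charFun B} _ :=
    .comp (part hψ) (.comp (.pair (part Computable.id.partrec) hask) .right)
  have hrec : Nat.RecursiveIn {charFun B} (fun n => Part.some (st n)) := by
    refine (Nat.RecursiveIn.comp (.prec (part (Computable.const (st 0)).partrec) hstep)
      (part (Primrec₂.natPair.to_comp.comp (Computable.const 0) Computable.id).partrec)).of_eq
        fun n => ?_
    simp only [PFun.coe_val, id, Part.bind_eq_bind, Part.bind_some, Nat.unpair_pair]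
    induction n with
    | zero => rfl
    | succ n ih =>
      simp only [ih, Part.bind_some]
      rw [← Part.eq_some_iff.2 (hst n)]
      simp [Seq.seq]
      exact Part.bind_some _ _
  refine (Nat.RecursiveIn.comp hask (.pair (part Computable.id.partrec) hrec)).of_eq fun n => ?_
  simp only [PFun.coe_val, id, charFun, Part.bind_eq_bind]
  have : (Nat.pair <$> Part.some n <*> Part.some (st n)) = Part.some (Nat.pair n (st n)) := by
    simp [Seq.seq]
  rw [this, Part.bind_some]
  congr 1
  classical
  simp only [Set.indicator_apply, hA]

end Oracle

/-! ### Reduction of each level to the previous one -/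

/-- Hilbert's Tenth Problem at level `i`, with finitely many odd primes made noninvertible: the
instance `e` asks for the polynomial `e.unpair.1`, without the divisors of
`2 * e.unpair.2 + 1`. -/
def levelProblem (i : ℕ) : Set ℕ := {e | e.unpair.1 ∈
  HTP (invertPrimes {v | v ∈ Set.range (levelEnum i) ∧ ¬ v ∣ 2 * e.unpair.2 + 1})}

theorem mem_levelProblem_iff {i e : ℕ} : e ∈ levelProblem i ↔ ∃ w, IsWitness e.unpair.1 w ∧
    ∀ v ∈ witnessBase w, v ∈ Set.range (levelEnum i) ∧ ¬ v ∣ 2 * e.unpair.2 + 1 := by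
  rw [levelProblem, Set.mem_ofPred_eq, mem_HTP_invertPrimes_iff]
  · rfl
  · exact fun h => Nat.not_prime_zero (range_levelEnum_subset i 0 h.1)

theorem mem_levelProblem_succ_iff {i e : ℕ} :
    e ∈ levelProblem (i + 1) ↔ finalAction (levelEnum i) e ≠ 0 := by
  rw [mem_levelProblem_iff, range_levelEnum_succ]
  exact (finalAction_ne_zero_iff (levelEnum_injective i) e).symm

/-- An upper bound for the positions restrained with higher priority than `e`. -/
def restraintBound (a : ℕ → ℕ) (e : ℕ) : ℕ :=
  ((List.range e).map fun e' => margin a e' * (e' + 2)).sum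

theorem lt_restraintBound {a : ℕ → ℕ} {e i : ℕ} (h : Restrained a e i) :
    i < restraintBound a e := by
  obtain ⟨e', he', -, h⟩ := h
  exact h.trans_le (List.le_sum_of_mem
    (List.mem_map_of_mem (f := fun e' => margin a e' * (e' + 2)) (List.mem_range.2 he')))

open scoped Classical in
/-- The product of the elements in restrained positions. -/
noncomputable def restrainedProd (q : ℕ → ℕ) (a : ℕ → ℕ) (e : ℕ) : ℕ :=
  (((List.range (restraintBound a e)).filter fun i => Restrained a e i).map q).prod

theorem restrainedProd_congr {q q' a a' : ℕ → ℕ} {e : ℕ} (ha : ∀ x < e, a x = a' x)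
    (hq : ∀ i < restraintBound a' e, q i = q' i) :
    restrainedProd q a e = restrainedProd q' a' e := by
  have hB : restraintBound a e = restraintBound a' e := by
    unfold restraintBound
    congr 1
    refine List.map_congr_left fun e' he' => ?_
    rw [margin_congr fun x hx => ha x (hx.trans_lt (List.mem_range.1 he'))]
  unfold restrainedProd
  rw [hB]
  rw [List.filter_congr fun i _ => decide_eq_decide.2 (restrained_congr (i := i) ha)]
  congr 1
  exact List.map_congr_left fun i hi =>
    hq i (List.mem_range.1 (List.mem_of_mem_filter hi))

theorem dvd_restrainedProd_iff {q a : ℕ → ℕ} {e v : ℕ} (hv : v.Prime) :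
    v ∣ restrainedProd q a e ↔ ∃ i, Restrained a e i ∧ v ∣ q i := by
  rw [restrainedProd, hv.prime.dvd_prod_iff]
  simp only [List.mem_map, List.mem_filter, List.mem_range, decide_eq_true_eq,
    exists_exists_and_eq_and]
  exact exists_congr fun i => ⟨fun h => ⟨h.1.2, h.2⟩, fun h => ⟨⟨lt_restraintBound h.1, h.1⟩, h.2⟩⟩

/-- The instance of the problem at one level that decides the instance `e` at the next level. -/
noncomputable def reducedInstance (q a : ℕ → ℕ) (e : ℕ) : ℕ :=
  Nat.pair e.unpair.1 (((2 * e.unpair.2 + 1) * restrainedProd q a e) / 2)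

/-- Excluding the terms in restrained positions amounts to excluding the prime divisors of their
product, so they are absorbed into the odd number of the instance. -/
theorem reducedInstance_mem_iff {i e : ℕ} :
    reducedInstance (levelEnum i) (finalAction (levelEnum i)) e ∈ levelProblem i ↔
      e ∈ levelProblem (i + 1) := by
  set q := levelEnum i with hq
  set a := finalAction q
  have hprime : ∀ j, (q j).Prime := fun j => range_levelEnum_subset i _ ⟨j, rfl⟩
  -- The prime 2 sits in position 0, which is never restrained.
  have hodd : Odd ((2 * e.unpair.2 + 1) * restrainedProd q a e) := by
    refine Odd.mul (odd_two_mul_add_one _) ?_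
    rw [← Nat.not_even_iff_odd, even_iff_two_dvd, dvd_restrainedProd_iff Nat.prime_two]
    rintro ⟨j, hj, hd⟩
    have h2 : q j = q 0 := by
      rw [hq, levelEnum_apply_zero]
      exact ((Nat.prime_dvd_prime_iff_eq Nat.prime_two (hprime j)).1 hd).symm
    rw [levelEnum_injective i h2] at hj
    exact not_restrained_zero _ _ hj
  have hdouble : 2 * (((2 * e.unpair.2 + 1) * restrainedProd q a e) / 2) + 1 =
      (2 * e.unpair.2 + 1) * restrainedProd q a e := Nat.two_mul_div_two_add_one_of_odd hodd
  rw [mem_levelProblem_succ_iff, finalAction_ne_zero_iff_not_restrained (levelEnum_injective i) e,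
    mem_levelProblem_iff, reducedInstance]
  simp only [Nat.unpair_pair, hdouble]
  refine exists_congr fun w => and_congr_right fun _ => forall₂_congr fun v _ => ?_
  constructor
  · rintro ⟨⟨j, rfl⟩, hnd⟩
    refine ⟨fun h => hnd (h.mul_right _), j, fun hr => hnd ?_, rfl⟩
    exact ((dvd_restrainedProd_iff (hprime j)).2 ⟨j, hr, dvd_rfl⟩).mul_left _
  · rintro ⟨hnd, j, hr, rfl⟩
    refine ⟨⟨j, rfl⟩, fun h => ?_⟩
    rcases (hprime j).dvd_mul.1 h with h | h
    · exact hnd h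
    · obtain ⟨k, hk, hkd⟩ := (dvd_restrainedProd_iff (hprime j)).1 h
      have hjk : q j = q k := (Nat.prime_dvd_prime_iff_eq (hprime j) (hprime k)).1 hkd
      rw [levelEnum_injective i hjk] at hr
      exact hr hk

section ReductionComputable

open Primrec

theorem primrec_restraintBound :
    Primrec fun p : List ℕ × ℕ => restraintBound (fun i => p.1.getD i 0) p.2 :=
  (list_sum nat_add).comp (list_map (list_range.comp snd)
    (nat_mul.comp (primrec_margin.comp (fst.comp fst) snd) (nat_add.comp snd (const 2))).to₂)

theorem primrec_reducedInstance : Primrec fun p : List ℕ × List ℕ × ℕ =>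
    reducedInstance (fun i => p.1.getD i 0) (fun i => p.2.1.getD i 0) p.2.2 := by
  classical
  have he : Primrec fun p : List ℕ × List ℕ × ℕ => p.2.2 := snd.comp snd
  have hprod : Primrec fun p : List ℕ × List ℕ × ℕ =>
      restrainedProd (fun i => p.1.getD i 0) (fun i => p.2.1.getD i 0) p.2.2 := by
    refine (list_prod nat_mul).comp (list_map (PrimrecPred.list_filter
      (p := fun (p : List ℕ × List ℕ × ℕ) i => Restrained (fun i => p.2.1.getD i 0) p.2.2 i) ?_
      (list_range.comp (primrec_restraintBound.comp snd)))
      ((list_getD 0).comp (fst.comp fst) snd).to₂)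
    exact primrecPred_restrained.comp ((fst.comp (snd.comp fst)).pair ((he.comp fst).pair snd))
  exact Primrec₂.natPair.comp (fst.comp (unpair.comp he))
    (nat_div.comp (nat_mul.comp (nat_double_succ.comp (snd.comp (unpair.comp he))) hprod) (const 2))

/-- The oracle query, as a function of the instance and the code of the final actions of higher
priority. -/
theorem exists_computable_query (i : ℕ) : ∃ H : ℕ → ℕ, Computable H ∧ ∀ e,
    H (Nat.pair e (Encodable.encode ((List.range e).map (finalAction (levelEnum i))))) =
      reducedInstance (levelEnum i) (finalAction (levelEnum i)) e := by
  have hex : ∀ n, ∃ s, n < (levelList i s).length := (levelList_spec i).2.1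
  have hL : Primrec (levelList i) := primrec_levelList.comp (const i) Primrec.id
  obtain ⟨F, hF, hFs⟩ : ∃ F : ℕ → ℕ, Computable F ∧ ∀ n, n < (levelList i (F n)).length :=
    ⟨_, Computable.find (P := fun n s => n < (levelList i s).length)
      (nat_lt.comp fst (list_length.comp (hL.comp snd))).computablePred hex,
      fun n => Nat.find_spec (hex n)⟩
  have hdec : Primrec (Denumerable.ofNat (List ℕ)) :=
    Primrec.encode_iff.1 <| Primrec.id.of_eq fun n => (Denumerable.encode_ofNat n).symm
  have hA : Primrec fun n : ℕ => (Denumerable.ofNat (List ℕ) n.unpair.2, n.unpair.1) :=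
    (hdec.comp (snd.comp unpair)).pair (fst.comp unpair)
  have hl : Computable fun n : ℕ => levelList i (F (restraintBound
      (fun j => (Denumerable.ofNat (List ℕ) n.unpair.2).getD j 0) n.unpair.1)) :=
    hL.to_comp.comp (hF.comp (primrec_restraintBound.comp hA).to_comp)
  refine ⟨_, primrec_reducedInstance.to_comp.comp (hl.pair hA.to_comp), fun e => ?_⟩
  simp only [Nat.unpair_pair, Denumerable.ofNat_encode, reducedInstance]
  congr 3
  have hget : ∀ x < e, ((List.range e).map (finalAction (levelEnum i))).getD x 0 =
      finalAction (levelEnum i) x := fun x hx => by simp [List.getD_eq_getElem?_getD, hx]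
  rw [restrainedProd_congr (a' := fun x =>
    ((List.range e).map (finalAction (levelEnum i))).getD x 0) (q' := levelEnum i) (fun _ _ => rfl)
    fun j hj => (prefixLimit_eq (levelList_spec i).1 (hj.trans (hFs _))).symm]
  exact restrainedProd_congr hget fun _ _ => rfl

/-- The final action of a requirement is found by a search, once the final actions of higher
priority and the answer to the oracle query are known. -/
theorem exists_partrec_search (i : ℕ) : ∃ ψ : ℕ →. ℕ, Partrec ψ ∧ ∀ e b,
    (b = 0 ↔ finalAction (levelEnum i) e = 0) →
    Encodable.encode ((List.range (e + 1)).map (finalAction (levelEnum i))) ∈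
      ψ (Nat.pair (Nat.pair e
        (Encodable.encode ((List.range e).map (finalAction (levelEnum i))))) b) := by
  classical
  set q := levelEnum i
  have hS : Computable fun s => (stageState q s).1 :=
    Computable.fst.comp (computable_stageState_levelEnum i)
  have hdec : Primrec (Denumerable.ofNat (List ℕ)) :=
    Primrec.encode_iff.1 <| Primrec.id.of_eq fun n => (Denumerable.encode_ofNat n).symm
  -- If the oracle answers no, the search stops at once. Otherwise it waits for a stage whose
  -- records agree with the known final ones of higher priority and whose own record is nonzero,
  -- hence final.
  let P : ℕ × List ℕ → Prop := fun p => p.1.unpair.2 = 0 ∨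
    ((List.range p.1.unpair.1.unpair.1).map (fun x => p.2.getD x 0) =
      Denumerable.ofNat (List ℕ) p.1.unpair.1.unpair.2 ∧ p.2.getD p.1.unpair.1.unpair.1 0 ≠ 0)
  let G : ℕ × List ℕ → ℕ := fun p => Encodable.encode
    (Denumerable.ofNat (List ℕ) p.1.unpair.1.unpair.2 ++
      [if p.1.unpair.2 = 0 then 0 else p.2.getD p.1.unpair.1.unpair.1 0])
  have hb : Primrec fun p : ℕ × List ℕ => p.1.unpair.2 := snd.comp (unpair.comp fst)
  have he : Primrec fun p : ℕ × List ℕ => p.1.unpair.1.unpair.1 :=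
    fst.comp (unpair.comp (fst.comp (unpair.comp fst)))
  have hl : Primrec fun p : ℕ × List ℕ => Denumerable.ofNat (List ℕ) p.1.unpair.1.unpair.2 :=
    hdec.comp (snd.comp (unpair.comp (fst.comp (unpair.comp fst))))
  have hv : Primrec fun p : ℕ × List ℕ => p.2.getD p.1.unpair.1.unpair.1 0 :=
    (list_getD 0).comp snd he
  have hP : PrimrecPred P := (Primrec.eq.comp hb (const 0)).or
    ((Primrec.eq.comp (list_map (list_range.comp he)
      ((list_getD 0).comp (snd.comp fst) snd).to₂) hl).and (Primrec.eq.comp hv (const 0)).not)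
  have hG : Primrec G := Primrec.encode.comp (list_append.comp hl (list_cons.comp
    (Primrec.ite (Primrec.eq.comp hb (const 0)) (const 0) hv) (const [])))
  have hpair : Computable fun p : ℕ × ℕ => (p.1, (stageState q p.2).1) :=
    Computable.fst.pair (hS.comp Computable.snd)
  refine ⟨fun x => (Nat.rfind fun s => Part.some (decide (P (x, (stageState q s).1)))).map
    fun s => G (x, (stageState q s).1), ?_, ?_⟩
  · refine Partrec.map (Partrec.rfind (p := fun x s =>
      Part.some (decide (P (x, (stageState q s).1)))) ?_) (hG.to_comp.comp hpair).to₂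
    exact (hP.decide.to_comp.comp hpair).partrec
  · intro e b hb0
    set h := finalAction q
    set x := Nat.pair (Nat.pair e (Encodable.encode ((List.range e).map h))) b with hx
    have hxb : x.unpair.2 = b := by simp [hx]
    have hxe : x.unpair.1.unpair.1 = e := by simp [hx]
    have hxl : Denumerable.ofNat (List ℕ) x.unpair.1.unpair.2 = (List.range e).map h := by simp [hx]
    have hPx : ∀ s, P (x, (stageState q s).1) ↔
        b = 0 ∨ ((∀ y < e, actionAt q s y = h y) ∧ actionAt q s e ≠ 0) := by
      intro s
      simp only [P, hxb, hxe, hxl]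
      rw [List.map_inj_left]
      simp only [List.mem_range]
      rfl
    have hGx : ∀ s, P (x, (stageState q s).1) →
        G (x, (stageState q s).1) = Encodable.encode ((List.range (e + 1)).map h) := by
      intro s hs
      simp only [G, hxb, hxe, hxl]
      rw [List.range_succ, List.map_append, List.map_singleton]
      congr 3
      by_cases hbz : b = 0
      · rw [if_pos hbz, hb0.1 hbz]
      · rw [if_neg hbz]
        obtain ⟨h₁, h₂⟩ := ((hPx s).1 hs).resolve_left hbz
        exact (finalAction_eq_of_agree h₁ h₂).symm
    have hexists : ∃ s, P (x, (stageState q s).1) := by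
      by_cases hbz : b = 0
      · exact ⟨0, (hPx 0).2 (Or.inl hbz)⟩
      · obtain ⟨s₀, hs₀⟩ := finalAction_spec q (e + 1)
        have := (hs₀ s₀ le_rfl).2
        refine ⟨s₀, (hPx s₀).2 (Or.inr ⟨fun y hy => this y (by omega), ?_⟩)⟩
        rw [this e (by omega)]
        exact fun h0 => hbz (hb0.2 h0)
    have hfind : Nat.find hexists ∈ Nat.rfind fun s =>
        Part.some (decide (P (x, (stageState q s).1))) := by
      refine Nat.mem_rfind.2 ⟨by simpa using Nat.find_spec hexists, fun {m} hm => ?_⟩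
      simpa using Nat.find_min hexists hm
    rw [← hGx _ (Nat.find_spec hexists)]
    exact Part.mem_map _ hfind

end ReductionComputable

/-- The recursion carries the list of final actions of priority below `e`. It determines the query,
and the answer both decides the instance `e` and guides the search for the next entry. -/
theorem levelProblem_succ_turingReducible (i : ℕ) :
    TuringReducible (charFun (levelProblem (i + 1))) (charFun (levelProblem i)) := by
  classical
  obtain ⟨H, hH, hHs⟩ := exists_computable_query i
  obtain ⟨ψ, hψ, hψs⟩ := exists_partrec_search i
  refine turingReducible_of_recursion hH hψ
    (fun e => Encodable.encode ((List.range e).map (finalAction (levelEnum i)))) ?_ ?_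
  · intro e
    apply hψs
    rw [hHs, Set.indicator_apply, reducedInstance_mem_iff, mem_levelProblem_succ_iff]
    split_ifs with h
    · simpa using h
    · simpa using h
  · intro e
    rw [hHs, reducedInstance_mem_iff]

theorem levelProblem_turingReducible (i : ℕ) :
    TuringReducible (charFun (levelProblem i)) (charFun (HTP ℚ)) := by
  induction i with
  | zero =>
    obtain ⟨f, hf, hfs⟩ := exists_semilocal_reduction
    refine turingReducible_of_computable hf fun e => ?_
    rw [← Nat.pair_unpair e, hfs, Nat.pair_unpair, levelProblem, Set.mem_ofPred_eq]
    have : {v | v ∈ Set.range (levelEnum 0) ∧ ¬ v ∣ 2 * e.unpair.2 + 1} =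
        {p | p.Prime ∧ ¬ p ∣ 2 * e.unpair.2 + 1} := by
      ext v
      exact and_congr_left fun _ => mem_range_levelEnum_zero
    rw [this]
  | succ i ih => exact (levelProblem_succ_turingReducible i).trans ih

/-- Hilbert's Tenth Problem at each level is Turing equivalent to the one over `ℚ`. -/
theorem setTuringEquivalent_level (i : ℕ) :
    SetTuringEquivalent (HTP (invertPrimes (Set.range (levelEnum i)))) (HTP ℚ) := by
  refine ⟨?_, turingReducible_of_computable primrec_clearDenominators.to_comp fun e =>
    clearDenominators_mem_HTP_iff.symm⟩
  refine TuringReducible.trans (turingReducible_of_computable (B := levelProblem i)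
    (f := fun e => Nat.pair e 0)
    (Primrec₂.natPair.to_comp.comp Computable.id (Computable.const 0)) fun e => ?_)
    (levelProblem_turingReducible i)
  rw [levelProblem, Set.mem_ofPred_eq]
  have : {v | v ∈ Set.range (levelEnum i) ∧ ¬ v ∣ 2 * (Nat.pair e 0).unpair.2 + 1} =
      Set.range (levelEnum i) := by
    ext v
    simp only [Set.mem_ofPred_eq, Nat.unpair_pair, mul_zero, zero_add, Nat.dvd_one,
      and_iff_left_iff_imp]
    exact fun hv => (range_levelEnum_subset i v hv).ne_one
  rw [this, Nat.unpair_pair]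

/-! ### Relative densities and the conclusion -/

theorem relProportion_nonneg (q : ℕ → ℕ) (S : Set ℕ) (n : ℕ) : 0 ≤ relProportion q S n := by
  unfold relProportion
  positivity

theorem ncard_image_Iio {q : ℕ → ℕ} (hq : Function.Injective q) (n : ℕ) :
    (q '' Set.Iio n).ncard = n := by
  rw [Set.ncard_image_of_injective _ hq, ← Finset.coe_Iio, Set.ncard_coe_finset, Nat.card_Iio]

theorem finite_image_Iio (q : ℕ → ℕ) (n : ℕ) : (q '' Set.Iio n).Finite :=
  (Set.finite_Iio n).image q

theorem relProportion_le_one {q : ℕ → ℕ} (hq : Function.Injective q) (S : Set ℕ) (n : ℕ) :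
    relProportion q S n ≤ 1 := by
  unfold relProportion
  refine div_le_one_of_le₀ ?_ n.cast_nonneg
  have := Set.ncard_le_ncard (Set.inter_subset_right (s := S)) (finite_image_Iio q n)
  rw [ncard_image_Iio hq] at this
  exact_mod_cast this

theorem relProportion_range_diff {q : ℕ → ℕ} (hq : Function.Injective q) (S : Set ℕ) {n : ℕ}
    (hn : n ≠ 0) : relProportion q (Set.range q \ S) n = 1 - relProportion q S n := by
  have hn' : (n : ℝ) ≠ 0 := Nat.cast_ne_zero.2 hn
  unfold relProportion
  rw [eq_sub_iff_add_eq, ← add_div, div_eq_one_iff_eq hn', ← Nat.cast_add, Nat.cast_inj]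
  have h₁ : (Set.range q \ S) ∩ q '' Set.Iio n = q '' Set.Iio n \ S := by
    ext v
    exact ⟨fun h => ⟨h.2, h.1.2⟩, fun h => ⟨⟨Set.image_subset_range _ _ h.1, h.2⟩, h.1⟩⟩
  rw [h₁, Set.inter_comm, add_comm,
    Set.ncard_inter_add_ncard_sdiff_eq_ncard _ _ (finite_image_Iio q n), ncard_image_Iio hq]

theorem relLowerDensity_eq_zero {q : ℕ → ℕ} (hq : Function.Injective q) {S : Set ℕ}
    (h : ∀ ε > 0, ∃ᶠ n in Filter.atTop, relProportion q S n ≤ ε) : relLowerDensity q S = 0 := by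
  have hb : Filter.IsBoundedUnder (· ≥ ·) Filter.atTop (relProportion q S) :=
    Filter.isBoundedUnder_of ⟨0, relProportion_nonneg q S⟩
  have hc : Filter.IsBoundedUnder (· ≤ ·) Filter.atTop (relProportion q S) :=
    Filter.isBoundedUnder_of ⟨1, relProportion_le_one hq S⟩
  refine le_antisymm (le_of_forall_pos_le_add fun ε hε => ?_) ?_
  · rw [zero_add]
    exact Filter.liminf_le_of_frequently_le (h ε hε) hb
  · exact Filter.le_liminf_of_le hc.isCoboundedUnder_ge
      (Filter.Eventually.of_forall (relProportion_nonneg q S))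

theorem relUpperDensity_range_diff_eq_one {q : ℕ → ℕ} (hq : Function.Injective q) {S : Set ℕ}
    (h : ∀ ε > 0, ∃ᶠ n in Filter.atTop, relProportion q S n ≤ ε) :
    relUpperDensity q (Set.range q \ S) = 1 := by
  have hb : Filter.IsBoundedUnder (· ≥ ·) Filter.atTop (relProportion q (Set.range q \ S)) :=
    Filter.isBoundedUnder_of ⟨0, relProportion_nonneg q _⟩
  have hc : Filter.IsBoundedUnder (· ≤ ·) Filter.atTop (relProportion q (Set.range q \ S)) :=
    Filter.isBoundedUnder_of ⟨1, relProportion_le_one hq _⟩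
  refine le_antisymm ?_ (le_of_forall_pos_le_add fun ε hε => ?_)
  · exact Filter.limsup_le_of_le hb.isCoboundedUnder_le
      (Filter.Eventually.of_forall (relProportion_le_one hq _))
  · rw [← sub_le_iff_le_add]
    refine Filter.le_limsup_of_frequently_le ?_ hc
    refine ((h ε hε).and_eventually (Filter.eventually_ne_atTop 0)).mono fun n hn => ?_
    rw [relProportion_range_diff hq S hn.2]
    linarith [hn.1]

/-- Up to suitable bounds, the thinned set contains few of the elements. -/
theorem relProportion_thinned_le {q : ℕ → ℕ} (hq : Function.Injective q) (e : ℕ) :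
    relProportion q (thinned q) (margin (finalAction q) e * (e + 2)) ≤ 1 / (e + 2 : ℝ) := by
  set m := margin (finalAction q) e
  have hm : 0 < m := Nat.succ_pos _
  -- All positions from m up to m(e + 2) carry the final restraint of `e`.
  have hsub : thinned q ∩ q '' Set.Iio (m * (e + 2)) ⊆ q '' Set.Iio m := by
    rintro _ ⟨hv, i, hi, rfl⟩
    refine ⟨i, Set.mem_Iio.2 (not_le.1 fun hmi => ?_), rfl⟩
    exact not_mem_thinned_of_restrained hq ⟨e, e.lt_succ_self, hmi, hi⟩ hv
  have hcard := Set.ncard_le_ncard hsub (finite_image_Iio q m)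
  rw [ncard_image_Iio hq] at hcard
  have hcard' : ((thinned q ∩ q '' Set.Iio (m * (e + 2))).ncard : ℝ) ≤ m := by exact_mod_cast hcard
  have hm' : (0 : ℝ) < m := by exact_mod_cast hm
  unfold relProportion
  push_cast
  rw [div_le_div_iff₀ (by positivity) (by positivity), one_mul]
  gcongr

theorem frequently_relProportion_thinned_le {q : ℕ → ℕ} (hq : Function.Injective q) :
    ∀ ε > 0, ∃ᶠ n in Filter.atTop, relProportion q (thinned q) n ≤ ε := by
  intro ε hε
  rw [Filter.frequently_atTop]
  intro n
  obtain ⟨k, hk⟩ := exists_nat_one_div_lt hε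
  -- Priority n + k serves both purposes: the bound exceeds n, and the proportion is at most 1 / (k
  -- + 1).
  refine ⟨margin (finalAction q) (n + k) * (n + k + 2), ?_, ?_⟩
  · have : 1 ≤ margin (finalAction q) (n + k) := Nat.succ_pos _
    nlinarith
  · refine (relProportion_thinned_le hq (n + k)).trans (le_trans ?_ hk.le)
    apply one_div_le_one_div_of_le (by positivity)
    push_cast
    linarith [n.cast_nonneg (α := ℝ)]

theorem thinned_ssubset {q : ℕ → ℕ} (hq : Function.Injective q) : thinned q ⊂ Set.range q := by
  refine ⟨thinned_subset, fun h => ?_⟩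
  refine not_mem_thinned_of_restrained hq (e := 1) (i := margin (finalAction q) 0)
    ⟨0, one_pos, le_rfl, ?_⟩ (h ⟨_, rfl⟩)
  have : 0 < margin (finalAction q) 0 := Nat.succ_pos _
  omega

theorem uniformlyCE_range {q : ℕ → ℕ → ℕ} (hq : Computable₂ q) :
    UniformlyCE fun i => Set.range (q i) := by
  have h : Partrec fun x : ℕ × ℕ => Nat.rfind fun n => Part.some (decide (q x.1 n = x.2)) := by
    refine Partrec.rfind (p := fun (x : ℕ × ℕ) n => Part.some (decide (q x.1 n = x.2))) ?_
    exact (Primrec.eq.decide.to_comp.comp (hq.comp (Computable.fst.comp Computable.fst)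
      Computable.snd) (Computable.snd.comp Computable.fst)).partrec
  refine h.dom_re.of_eq fun x => ?_
  refine Nat.rfind_dom.trans ?_
  simp

theorem mainTheorem9 :
    ∃ (W : ℕ → Set ℕ) (q : ℕ → ℕ → ℕ),
      W 0 = {p | Nat.Prime p} ∧
      (∀ i, W (i + 1) ⊂ W i) ∧
      UniformlyCE W ∧
      IsUniformEnumeration W q ∧
      StrictMono (q 0) ∧
      (∀ i, SetTuringEquivalent (HTP (invertPrimes (W i))) (HTP ℚ)) ∧
      (∀ i, relUpperDensity (q i) (W i \ W (i + 1)) = 1) ∧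
      (∀ i, relLowerDensity (q i) (W (i + 1)) = 0) := by
  refine ⟨fun i => Set.range (levelEnum i), levelEnum, Set.ext fun v => mem_range_levelEnum_zero,
    fun i => ?_, uniformlyCE_range computable_levelEnum,
    ⟨computable_levelEnum, levelEnum_injective, fun _ => rfl⟩, levelEnum_zero_strictMono,
    setTuringEquivalent_level, fun i => ?_, fun i => ?_⟩
  · simp only [range_levelEnum_succ]
    exact thinned_ssubset (levelEnum_injective i)
  · simp only [range_levelEnum_succ]
    exact relUpperDensity_range_diff_eq_one (levelEnum_injective i)
      (frequently_relProportion_thinned_le (levelEnum_injective i))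
  · simp only [range_levelEnum_succ]
    exact relLowerDensity_eq_zero (levelEnum_injective i)
      (frequently_relProportion_thinned_le (levelEnum_injective i))
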